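/- For an integer $k\ge 2$ let $\mathcal J_k(\mathbb Z)$ be the group, under composition (substitution), of all formal power series of the form $x+\sum_{i\ge k}a_i x^i$ with $a_i\in\mathbb Z$, and let $H_1(\mathcal J_k(\mathbb Z))=\mathcal J_k(\mathbb Z)/[\mathcal J_k(\mathbb Z),\mathcal J_k(\mathbb Z)]$ be its abelianization (as an abstract group). Then, as abelian groups: (a) if $k\equiv 3\pmod 4$, then $H_1(\mathcal J_k(\mathbb Z))\cong \mathbb Z^k\oplus(\mathbb Z/2\mathbb Z)^{(k+1)/2}$; (b) if $k\equiv 2\pmod 4$, then $H_1(\mathcal J_k(\mathbb Z))\cong \mathbb Z^k\oplus(\mathbb Z/2\mathbb Z)^{(k+2)/2}$; (c) if $k\equiv 1\pmod 4$, then $H_1(\mathcal J_k(\mathbb Z))\cong \mathbb Z^k\oplus\mathbb Z/4\mathbb Z\oplus(\mathbb Z/2\mathbb Z)^{(k-3)/2}$; (d) if $k\equiv 0\pmod 4$, then $H_1(\mathcal J_k(\mathbb Z))\cong \mathbb Z^k\oplus\mathbb Z/4\mathbb Z\oplus(\mathbb Z/2\mathbb Z)^{(k-2)/2}$. -/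

import Mathlib

/-- The underlying type of the Jennings group over `R`: the power series
`x + ∑_{i ≥ 2} a_i x^i` with coefficients in `R`. -/
def Jennings (R : Type*) [CommRing R] : Type _ :=
  {f : PowerSeries R // PowerSeries.coeff 0 f = 0 ∧ PowerSeries.coeff 1 f = 1}

namespace Jennings

variable {R : Type*} [CommRing R]

theorem hasSubst (f : Jennings R) : PowerSeries.HasSubst f.1 :=
  PowerSeries.HasSubst.of_constantCoeff_zero' (by simpa using f.2.1)

theorem mem_iff_dvd (f : PowerSeries R) :
    (PowerSeries.coeff 0 f = 0 ∧ PowerSeries.coeff 1 f = 1) ↔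
      (PowerSeries.X : PowerSeries R) ^ 2 ∣ f - PowerSeries.X := by
  rw [PowerSeries.X_pow_dvd_iff]
  constructor
  · rintro ⟨h0, h1⟩ m hm
    interval_cases m
    · simpa using h0
    · simp [h1]
  · intro h
    have h0 := h 0 (by norm_num)
    have h1 := h 1 (by norm_num)
    refine ⟨by simpa using h0, ?_⟩
    simpa [sub_eq_zero] using h1

theorem X_dvd (f : Jennings R) : (PowerSeries.X : PowerSeries R) ∣ f.1 := by
  rw [PowerSeries.X_dvd_iff]
  simpa using f.2.1

theorem subst_sub_dvd {k : ℕ} {f : PowerSeries R} (g : Jennings R)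
    (hf : (PowerSeries.X : PowerSeries R) ^ k ∣ f - PowerSeries.X) :
    (PowerSeries.X : PowerSeries R) ^ k ∣ PowerSeries.subst g.1 f - g.1 := by
  obtain ⟨h, hh⟩ := hf
  have e : f = PowerSeries.X + PowerSeries.X ^ k * h := by rw [← hh]; ring
  have hg := g.hasSubst
  rw [e, PowerSeries.subst_add hg, PowerSeries.subst_mul hg, PowerSeries.subst_pow hg,
    PowerSeries.subst_X hg, add_sub_cancel_left]
  exact Dvd.dvd.mul_right (pow_dvd_pow_of_dvd g.X_dvd k) _

theorem isUnit_coeff_one (f : Jennings R) : IsUnit (PowerSeries.coeff 1 f.1) := by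
  rw [f.2.2]; exact isUnit_one

/-- The group structure is composition: `f * g = f ∘ g`, that is, `g` is substituted into `f`. -/
noncomputable instance : Mul (Jennings R) where
  mul f g := ⟨PowerSeries.subst g.1 f.1, by
    rw [mem_iff_dvd]
    have h1 := subst_sub_dvd g ((mem_iff_dvd f.1).1 f.2)
    have h2 := (mem_iff_dvd g.1).1 g.2
    simpa using dvd_add h1 h2⟩

/-- The identity is the series `x`. -/
noncomputable instance : One (Jennings R) where
  one := ⟨PowerSeries.X, by simp⟩

/-- The inverse is the compositional inverse. -/
noncomputable instance : Inv (Jennings R) where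
  inv f := ⟨PowerSeries.substInvOfIsUnit f.1 f.isUnit_coeff_one, by
    refine ⟨by simp, ?_⟩
    have h := PowerSeries.coeff_one_substInvOfIsUnit f.1 f.isUnit_coeff_one
    have hu : f.isUnit_coeff_one.unit = 1 := Units.ext f.2.2
    rw [h, hu]; simp⟩

theorem coe_mul (f g : Jennings R) : (f * g).1 = PowerSeries.subst g.1 f.1 := rfl

theorem coe_one : (1 : Jennings R).1 = PowerSeries.X := rfl

theorem coe_inv (f : Jennings R) :
    (f⁻¹).1 = PowerSeries.substInvOfIsUnit f.1 f.isUnit_coeff_one := rfl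

noncomputable instance : Group (Jennings R) :=
  Group.ofLeftAxioms
    (fun f g h => Subtype.ext (by
      rw [coe_mul, coe_mul, coe_mul, coe_mul]
      exact (PowerSeries.subst_comp_subst_apply g.hasSubst h.hasSubst f.1)))
    (fun f => Subtype.ext (by rw [coe_mul, coe_one]; exact PowerSeries.subst_X f.hasSubst))
    (fun f => Subtype.ext (by
      rw [coe_mul, coe_one, coe_inv]
      exact PowerSeries.subst_substInvOfIsUnit_left f.1 (by simpa using f.2.1) f.isUnit_coeff_one))

theorem coeff_eq_zero_iff_dvd (k : ℕ) (f : Jennings R) :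
    (∀ i, 2 ≤ i → i < k → PowerSeries.coeff i f.1 = 0) ↔
      (PowerSeries.X : PowerSeries R) ^ k ∣ f.1 - PowerSeries.X := by
  rw [PowerSeries.X_pow_dvd_iff]
  constructor
  · intro h m hm
    rcases Nat.lt_or_ge m 2 with h2 | h2
    · exact PowerSeries.X_pow_dvd_iff.1 ((mem_iff_dvd f.1).1 f.2) m h2
    · rw [map_sub, h m h2 hm, PowerSeries.coeff_X, if_neg (by omega), sub_zero]
  · intro h i h2 hi
    have := h i hi
    rwa [map_sub, PowerSeries.coeff_X, if_neg (by omega), sub_zero] at this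

/-- The subgroup of the series `x + ∑_{i ≥ k} a_i x^i`. -/
def level (R : Type*) [CommRing R] (k : ℕ) : Subgroup (Jennings R) where
  carrier := {f | ∀ i, 2 ≤ i → i < k → PowerSeries.coeff i f.1 = 0}
  one_mem' := by
    intro i h2 _
    rw [coe_one, PowerSeries.coeff_X, if_neg (by omega)]
  mul_mem' := by
    intro f g hf hg i h2 hi
    have hf' := (coeff_eq_zero_iff_dvd k f).1 hf
    have hg' := (coeff_eq_zero_iff_dvd k g).1 hg
    have h : (PowerSeries.X : PowerSeries R) ^ k ∣ (f * g).1 - PowerSeries.X := by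
      simpa [coe_mul] using dvd_add (subst_sub_dvd g hf') hg'
    exact (coeff_eq_zero_iff_dvd k (f * g)).2 h i h2 hi
  inv_mem' := by
    intro f hf i h2 hi
    have hf' := (coeff_eq_zero_iff_dvd k f).1 hf
    have h := subst_sub_dvd f⁻¹ hf'
    rw [← coe_mul, mul_inv_cancel, coe_one, dvd_sub_comm] at h
    exact (coeff_eq_zero_iff_dvd k f⁻¹).2 h i h2 hi

end Jennings

/-! Put `d = k - 1`, so that the group is `V ℤ d`, filtered by the subgroups `V ℤ n`; `co f n` is
the coefficient of depth `n`. Composition adds coefficients up to corrections of higher depth, so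
commutators lie in `V ℤ (2 * d + 1)`. The `d + 1` coefficients of depth `d, ..., 2 * d`, the last
with a quadratic correction, form a homomorphism onto a free group with kernel `V ℤ (2 * d + 1)`. It
splits, and what remains is `V ℤ (2 * d + 1)` modulo `⁅V ℤ d, V ℤ d⁆`.

Upper bound. Let `e_m = x + x ^ (m + 1)`. The commutator `[e_m, e_n]` has leading coefficient `m -
n` at depth `m + n`, so commutators realise every leading coefficient at odd depths and every even
one at even depths. Where leading terms cancel in a product of such commutators, the next term, at
depth `n + 2 * m`, is odd for `n % 4 = 2`. This settles all but about `d / 2` even depths, none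
above `3 * d + 5`. Finitely many corrections then suffice, because all of `V ℤ (10 * d + 20)`
consists of products of four commutators (`V_le_commutator`).

Lower bound. Modulo 2 the derivative of `f` is a series `ev f` in `x ^ 2`, and the chain rule
becomes `ev_mul`. It forces the even-depth coefficients of a commutator to vanish modulo 2 up to
depth about `3 * d`, and gives the next few as alternating bilinear forms. Where such a form also
appears at depth `2 * d + 1`, adding that coefficient makes the sum even, and a factor `ZMod 2`
survives. For `d % 4 = 0` or `3` the form instead appears, doubled modulo 4, at a lower even depth
`n₁`; then `co f n₁ + 2 * co f n₂`, with one more term for `d = 3`, is divisible by 4 on commutators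
and yields the `ZMod 4`. -/

namespace Jennings

open PowerSeries
open scoped commutatorElement

/-! ### Coefficients of composites and the depth filtration. -/

section Coefficients

variable {R : Type*} [CommRing R]

/-- The coefficient of `x ^ (n + 1)`. -/
noncomputable def co (f : Jennings R) (n : ℕ) : R := coeff (n + 1) f.1

/-- The series `h` with `f = x (1 + h)`. -/
noncomputable def tl (f : Jennings R) : PowerSeries R := PowerSeries.mk fun n => if n = 0 then 0 else co f n

/-- The subgroup of the series `x + O(x ^ (n + 1))`. -/
abbrev V (R : Type*) [CommRing R] (n : ℕ) : Subgroup (Jennings R) := level R (n + 1)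

@[simp] theorem co_zero (f : Jennings R) : co f 0 = 1 := f.2.2

theorem ext_co {f g : Jennings R} (h : ∀ n, co f n = co g n) : f = g := by
  apply Subtype.ext
  ext n
  rcases n with _ | n
  · rw [f.2.1, g.2.1]
  · exact h n

theorem mem_V {n : ℕ} {f : Jennings R} : f ∈ V R n ↔ ∀ i, 1 ≤ i → i < n → co f i = 0 := by
  constructor
  · intro h i h1 h2
    exact h (i + 1) (by omega) (by omega)
  · intro h i h1 h2
    have := h (i - 1) (by omega) (by omega)
    rwa [co, Nat.sub_add_cancel (by omega)] at this

theorem mem_V_iff_dvd {n : ℕ} {f : Jennings R} :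
    f ∈ V R n ↔ (X : PowerSeries R) ^ (n + 1) ∣ f.1 - X := coeff_eq_zero_iff_dvd (n + 1) f

theorem V_anti {m n : ℕ} (h : m ≤ n) : V R n ≤ V R m := fun _ hf =>
  mem_V.2 fun i h1 h2 => mem_V.1 hf i h1 (by omega)

@[simp] theorem coeff_tl_zero (f : Jennings R) : coeff 0 (tl f) = 0 := by simp [tl]

@[simp] theorem constantCoeff_tl (f : Jennings R) : constantCoeff (tl f) = 0 := by
  rw [← coeff_zero_eq_constantCoeff_apply, coeff_tl_zero]

theorem coeff_tl (f : Jennings R) {n : ℕ} (hn : 1 ≤ n) : coeff n (tl f) = co f n := by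
  simp [tl, show n ≠ 0 by omega]

theorem eq_X_mul (f : Jennings R) : f.1 = X * (1 + tl f) := by
  ext n
  rcases n with _ | n
  · rw [f.2.1]; simp
  · rw [coeff_succ_X_mul, map_add, coeff_one]
    rcases n with _ | n
    · rw [f.2.2]; simp
    · rw [coeff_tl f (by omega)]; simp [co]

theorem X_pow_dvd_tl {n : ℕ} {f : Jennings R} (hf : f ∈ V R n) : (X : PowerSeries R) ^ n ∣ tl f := by
  rw [X_pow_dvd_iff]
  intro m hm
  rcases m with _ | m
  · simp
  · rw [coeff_tl f (by omega)]; exact mem_V.1 hf _ (by omega) hm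

theorem exists_one_add_pow (h : PowerSeries R) (i : ℕ) :
    ∃ q, (1 + h) ^ i = 1 + (i : PowerSeries R) * h + (i.choose 2 : PowerSeries R) * h ^ 2 + h ^ 3 * q := by
  induction i with
  | zero => exact ⟨0, by simp⟩
  | succ i ih =>
    obtain ⟨q, hq⟩ := ih
    refine ⟨q * (1 + h) + (i.choose 2 : PowerSeries R), ?_⟩
    rw [pow_succ, hq, Nat.choose_succ_succ' i 1, Nat.choose_one_right]
    push_cast
    ring

theorem natCast_eq_C (i : ℕ) : (i : PowerSeries R) = C (i : R) := by simp

theorem coeff_one_add_pow {h : PowerSeries R} {b r : ℕ} (hb : X ^ b ∣ h) (hr : r < 3 * b) (i : ℕ) :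
    coeff r ((1 + h) ^ i) = (if r = 0 then 1 else 0) + i * coeff r h + i.choose 2 * coeff r (h ^ 2) := by
  obtain ⟨q, hq⟩ := exists_one_add_pow h i
  have h3 : (X : PowerSeries R) ^ (3 * b) ∣ h ^ 3 * q := by
    rw [mul_comm 3 b, pow_mul]
    exact Dvd.dvd.mul_right (pow_dvd_pow_of_dvd hb 3) q
  rw [hq, map_add, X_pow_dvd_iff.1 h3 r hr, natCast_eq_C, natCast_eq_C, map_add, map_add,
    coeff_C_mul, coeff_C_mul, coeff_one, add_zero]

theorem coeff_mul_of_dvd {A B : PowerSeries R} {a b : ℕ} (hA : X ^ a ∣ A) (hB : X ^ b ∣ B) (r : ℕ) :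
    coeff (a + b + r) (A * B) =
      ∑ i ∈ Finset.range (r + 1), coeff (a + i) A * coeff (b + (r - i)) B := by
  obtain ⟨A', rfl⟩ := hA
  obtain ⟨B', rfl⟩ := hB
  have e : (X : PowerSeries R) ^ a * A' * (X ^ b * B') = X ^ (a + b) * (A' * B') := by ring
  rw [e, add_comm (a + b) r, coeff_X_pow_mul, coeff_mul, Finset.Nat.sum_antidiagonal_eq_sum_range_succ_mk]
  refine Finset.sum_congr rfl fun i _ => ?_
  rw [add_comm a, add_comm b, coeff_X_pow_mul, coeff_X_pow_mul]

theorem coeff_mul_eq_zero_of_dvd {A B : PowerSeries R} {a b n : ℕ} (hA : X ^ a ∣ A) (hB : X ^ b ∣ B)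
    (hn : n < a + b) : coeff n (A * B) = 0 := by
  have : (X : PowerSeries R) ^ (a + b) ∣ A * B := by rw [pow_add]; exact mul_dvd_mul hA hB
  exact X_pow_dvd_iff.1 this n hn

theorem coeff_subst_eq_sum (p : PowerSeries R) (g : Jennings R) (N : ℕ) :
    coeff N (p.subst g.1) =
      ∑ i ∈ Finset.range (N + 1), coeff i p * coeff (N - i) ((1 + tl g) ^ i) := by
  have key : ∀ i, coeff N (g.1 ^ i) = if i ≤ N then coeff (N - i) ((1 + tl g) ^ i) else 0 := by
    intro i
    rw [eq_X_mul g, mul_pow, coeff_X_pow_mul']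
  rw [coeff_subst' g.hasSubst, finsum_eq_sum_of_support_subset (s := Finset.range (N + 1))]
  · refine Finset.sum_congr rfl fun i hi => ?_
    rw [Finset.mem_range] at hi
    rw [key, if_pos (by omega), smul_eq_mul]
  · intro i hi
    rw [Function.mem_support] at hi
    by_contra hc
    simp only [Finset.coe_range, Set.mem_Iio] at hc
    exact hi (by rw [key, if_neg (by omega), smul_zero])

/-- Only the powers `(1 + tl g) ^ i` with `i ≥ j` matter, each expanded to second order: `tl g ^ 3`
starts at depth `3 * b`, out of reach when `r < 2 * b`. -/
theorem coeff_subst_of_dvd {p : PowerSeries R} {g : Jennings R} {j b r : ℕ} (hp : X ^ j ∣ p)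
    (hg : g ∈ V R b) (hb : 1 ≤ b) (hr : r < 2 * b) :
    coeff (j + b + r) (p.subst g.1) = coeff (j + b + r) p +
      ∑ i ∈ Finset.range (r + 1), coeff (j + i) p * ((j + i : ℕ) * co g (b + (r - i)) +
        (j + i).choose 2 * coeff (b + (r - i)) (tl g ^ 2)) := by
  have ht := X_pow_dvd_tl hg
  rw [coeff_subst_eq_sum, show j + b + r + 1 = j + ((r + 1) + b) by ring, Finset.sum_range_add,
    Finset.sum_range_add]
  have h1 : ∑ i ∈ Finset.range j, coeff i p * coeff (j + b + r - i) ((1 + tl g) ^ i) = 0 := by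
    refine Finset.sum_eq_zero fun i hi => ?_
    rw [X_pow_dvd_iff.1 hp i (Finset.mem_range.1 hi), zero_mul]
  rw [h1, zero_add, add_comm (coeff (j + b + r) p)]
  congr 1
  · refine Finset.sum_congr rfl fun i hi => ?_
    rw [Finset.mem_range] at hi
    rw [show j + b + r - (j + i) = b + (r - i) by omega, coeff_one_add_pow ht (by omega),
      if_neg (by omega), coeff_tl _ (by omega)]
    ring
  · obtain ⟨c, rfl⟩ : ∃ c, b = c + 1 := ⟨b - 1, by omega⟩
    rw [Finset.sum_range_succ, Finset.sum_eq_zero, zero_add]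
    · rw [show j + (c + 1) + r - (j + (r + 1 + c)) = 0 by omega,
        show j + (r + 1 + c) = j + (c + 1) + r by omega]
      simp
    · intro i hi
      rw [Finset.mem_range] at hi
      rw [show j + (c + 1) + r - (j + (r + 1 + i)) = c - i by omega, coeff_one_add_pow ht (by omega),
        if_neg (by omega), X_pow_dvd_iff.1 ht _ (by omega), sq,
        coeff_mul_eq_zero_of_dvd ht ht (by omega)]
      simp

theorem coeff_subst_of_lt {p : PowerSeries R} {g : Jennings R} {j b n : ℕ} (hp : X ^ j ∣ p)
    (hg : g ∈ V R b) (hn : n < j + b) : coeff n (p.subst g.1) = coeff n p := by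
  have ht := X_pow_dvd_tl hg
  rw [coeff_subst_eq_sum, Finset.sum_range_succ, Finset.sum_eq_zero, zero_add]
  · simp
  · intro i hi
    rw [Finset.mem_range] at hi
    rcases lt_or_ge i j with h | h
    · rw [X_pow_dvd_iff.1 hp i h, zero_mul]
    · rw [coeff_one_add_pow ht (by omega), if_neg (by omega), X_pow_dvd_iff.1 ht _ (by omega), sq,
        coeff_mul_eq_zero_of_dvd ht ht (by omega)]
      simp

theorem co_mul_eq (f g : Jennings R) (n : ℕ) :
    co (f * g) n = co g n + coeff (n + 1) ((f.1 - X).subst g.1) := by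
  rw [subst_sub g.hasSubst, subst_X g.hasSubst, map_sub, co, co, coe_mul]
  ring

theorem coeff_sub_X (f : Jennings R) {n : ℕ} (hn : 1 ≤ n) : coeff (n + 1) (f.1 - X) = co f n := by
  rw [map_sub, coeff_X, if_neg (by omega), sub_zero, co]

theorem co_mul_of_lt {f g : Jennings R} {a b n : ℕ} (hf : f ∈ V R a) (hg : g ∈ V R b) (hn : 1 ≤ n)
    (h : n < a + b) : co (f * g) n = co f n + co g n := by
  rw [co_mul_eq, coeff_subst_of_lt (mem_V_iff_dvd.1 hf) hg (by omega), coeff_sub_X _ hn, add_comm]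

theorem co_mul {f g : Jennings R} {a b r : ℕ} (hf : f ∈ V R a) (hg : g ∈ V R b) (ha : 1 ≤ a)
    (hb : 1 ≤ b) (hr : r < 2 * b) :
    co (f * g) (a + b + r) = co f (a + b + r) + co g (a + b + r) +
      ∑ i ∈ Finset.range (r + 1), co f (a + i) * ((a + i + 1 : ℕ) * co g (b + (r - i)) +
        (a + i + 1).choose 2 * coeff (b + (r - i)) (tl g ^ 2)) := by
  rw [co_mul_eq, show a + b + r + 1 = (a + 1) + b + r by ring,
    coeff_subst_of_dvd (mem_V_iff_dvd.1 hf) hg hb hr, show (a + 1) + b + r = a + b + r + 1 by ring,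
    coeff_sub_X f (by omega), ← add_assoc, add_comm (co g _)]
  refine congrArg _ (Finset.sum_congr rfl fun i _ => ?_)
  rw [show a + 1 + i = a + i + 1 by ring, coeff_sub_X f (by omega)]

theorem coeff_tl_sq_of_lt {g : Jennings R} {b n : ℕ} (hg : g ∈ V R b) (hn : n < 2 * b) :
    coeff n (tl g ^ 2) = 0 := by
  rw [sq]; exact coeff_mul_eq_zero_of_dvd (X_pow_dvd_tl hg) (X_pow_dvd_tl hg) (by omega)

theorem coeff_tl_sq {g : Jennings R} {b r : ℕ} (hb : 1 ≤ b) (hg : g ∈ V R b) :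
    coeff (2 * b + r) (tl g ^ 2) = ∑ i ∈ Finset.range (r + 1), co g (b + i) * co g (b + (r - i)) := by
  rw [sq, two_mul, coeff_mul_of_dvd (X_pow_dvd_tl hg) (X_pow_dvd_tl hg)]
  refine Finset.sum_congr rfl fun i _ => ?_
  rw [coeff_tl _ (by omega), coeff_tl _ (by omega)]

theorem co_mul_of_lt_depth {f g : Jennings R} {a b r : ℕ} (hf : f ∈ V R a) (hg : g ∈ V R b) (ha : 1 ≤ a)
    (hr : r < b) :
    co (f * g) (a + b + r) = co f (a + b + r) + co g (a + b + r) +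
      ∑ i ∈ Finset.range (r + 1), (a + i + 1 : ℕ) * (co f (a + i) * co g (b + (r - i))) := by
  rw [co_mul hf hg ha (by omega) (by omega)]
  congr 1
  refine Finset.sum_congr rfl fun i _ => ?_
  rw [coeff_tl_sq_of_lt hg (by omega)]
  ring

/-- Congruence modulo `V n` is congruence of the series modulo `x ^ (n + 1)`. -/
theorem mul_inv_mem_V {f g : Jennings R} {n : ℕ} : f * g⁻¹ ∈ V R n ↔ ∀ i < n, co f i = co g i := by
  have h1 : (∀ i < n, co f i = co g i) ↔ X ^ (n + 1) ∣ f.1 - g.1 := by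
    rw [X_pow_dvd_iff]
    constructor
    · intro h m hm
      rcases m with _ | m
      · rw [map_sub, f.2.1, g.2.1, sub_zero]
      · rw [map_sub, sub_eq_zero]; exact h m (by omega)
    · intro h i hi
      have := h (i + 1) (by omega)
      rwa [map_sub, sub_eq_zero] at this
  rw [h1, mem_V_iff_dvd]
  constructor
  · intro h
    have := subst_sub_dvd g h
    rwa [← coe_mul, inv_mul_cancel_right] at this
  · rintro ⟨q, hq⟩
    have : (f * g⁻¹).1 - X = subst (g⁻¹).1 (f.1 - g.1) := by
      rw [subst_sub g⁻¹.hasSubst, ← coe_mul, ← coe_mul, mul_inv_cancel, coe_one]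
    rw [this, hq, subst_mul g⁻¹.hasSubst, subst_pow g⁻¹.hasSubst, subst_X g⁻¹.hasSubst]
    exact Dvd.dvd.mul_right (pow_dvd_pow_of_dvd g⁻¹.X_dvd _) _

/-- Below depth `a + b` composition is addition of coefficients, so `f * g` and `g * f` agree there.
-/
theorem commutator_mem {f g : Jennings R} {a b : ℕ} (hf : f ∈ V R a) (hg : g ∈ V R b) :
    ⁅f, g⁆ ∈ V R (a + b) := by
  rw [commutatorElement_def, mul_assoc, ← mul_inv_rev, mul_inv_mem_V]
  intro i hi
  rcases Nat.eq_zero_or_pos i with rfl | h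
  · simp
  · rw [co_mul_of_lt hf hg h hi, co_mul_of_lt hg hf h (by omega), add_comm]

instance V_normal (n : ℕ) : (V R n).Normal where
  conj_mem f hf g := by
    have h : g ∈ V R 0 := mem_V.2 fun i _ h2 => by omega
    have h1 := mul_mem (commutator_mem h hf) (show f ∈ V R (0 + n) by rwa [zero_add])
    rwa [commutatorElement_def, inv_mul_cancel_right, zero_add] at h1

end Coefficients

end Jennings

/-! ### Splitting the abelianization into its free part and the rest. -/

theorem nonempty_abelianization_equiv_prod {G : Type*} [Group G] {k : ℕ} {T : Type*} [AddCommGroup T]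
    (π : G →* Multiplicative (Fin k → ℤ)) (hπ : Function.Surjective π)
    (χ : π.ker →* Multiplicative T) (hχ : Function.Surjective χ)
    (hker : ∀ v : π.ker, χ v = 1 ↔ (v : G) ∈ commutator G) :
    Nonempty (Additive (Abelianization G) ≃+ (Fin k → ℤ) × T) := by
  let p : Additive (Abelianization G) →+ (Fin k → ℤ) := MonoidHom.toAdditiveLeft (Abelianization.lift π)
  have hp : ∀ g : G, p (Additive.ofMul (Abelianization.of g)) = (π g).toAdd := fun g => by
    simp [p]
  have hof : ∀ a : Additive (Abelianization G), ∃ g : G, a = Additive.ofMul (Abelianization.of g) := by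
    intro a
    obtain ⟨g, hg⟩ := QuotientGroup.mk_surjective a.toMul
    exact ⟨g, by rw [← ofMul_toMul a, ← hg]; rfl⟩
  have hof1 : ∀ g : G, Abelianization.of g = 1 ↔ g ∈ commutator G := fun g => by
    rw [← MonoidHom.mem_ker, Abelianization.ker_of]
  have hps : Function.Surjective p.toIntLinearMap := by
    intro y
    obtain ⟨g, hg⟩ := hπ (Multiplicative.ofAdd y)
    exact ⟨Additive.ofMul (Abelianization.of g), by simp [hp, hg]⟩
  -- The quotient `ℤ ^ k` is projective, so the extension splits; the complement is `π.ker` modulo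
  -- `commutator G`, which `χ` identifies with `T`.
  obtain ⟨s, hs⟩ := Module.projective_lifting_property p.toIntLinearMap LinearMap.id hps
  have hs' : ∀ y, p (s y) = y := fun y => LinearMap.congr_fun hs y
  let e0 : π.ker →* Abelianization G := Abelianization.of.comp π.ker.subtype
  have he0 : χ.ker ≤ e0.ker := by
    intro v hv
    exact (hof1 _).2 ((hker v).1 hv)
  let e1 : Multiplicative T →* Abelianization G := χ.liftOfSurjective hχ ⟨e0, he0⟩
  have he1 : ∀ v, e1 (χ v) = Abelianization.of (v : G) := fun v =>
    MonoidHom.liftOfRightInverse_comp_apply _ _ _ ⟨e0, he0⟩ v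
  let e2 : T →+ Additive (Abelianization G) := MonoidHom.toAdditiveRight e1
  have he2 : ∀ v, e2 (χ v).toAdd = Additive.ofMul (Abelianization.of (v : G)) := fun v => by
    simp [e2, he1]
  have hpe : ∀ t, p (e2 t) = 0 := by
    intro t
    obtain ⟨v, hv⟩ := hχ (Multiplicative.ofAdd t)
    have := he2 v
    rw [hv, toAdd_ofAdd] at this
    rw [this, hp, MonoidHom.mem_ker.1 v.2, toAdd_one]
  let Φ : (Fin k → ℤ) × T →+ Additive (Abelianization G) := s.toAddMonoidHom.coprod e2
  have hΦ : ∀ y t, Φ (y, t) = s y + e2 t := fun y t => by simp [Φ]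
  refine ⟨(AddEquiv.ofBijective Φ ⟨?_, ?_⟩).symm⟩
  · rw [injective_iff_map_eq_zero]
    rintro ⟨y, t⟩ h
    rw [hΦ] at h
    have hy : y = 0 := by
      have := congrArg p h
      rwa [map_add, hs', hpe, add_zero, map_zero] at this
    subst hy
    obtain ⟨v, hv⟩ := hχ (Multiplicative.ofAdd t)
    have h2 := he2 v
    rw [hv, toAdd_ofAdd] at h2
    rw [map_zero, zero_add, h2] at h
    have h3 := (hker v).2 ((hof1 _).1 h)
    rw [hv] at h3
    rw [show t = 0 from h3]
    rfl
  · intro a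
    obtain ⟨g, hg⟩ := hof (a - s (p a))
    have hk : g ∈ π.ker := by
      have := congrArg p hg
      rw [map_sub, hs', sub_self, hp] at this
      exact this.symm
    refine ⟨(p a, (χ ⟨g, hk⟩).toAdd), ?_⟩
    rw [hΦ, he2, ← hg]
    abel

namespace Jennings

open PowerSeries
open scoped commutatorElement

/-- The Jennings series with prescribed coefficients. -/
def ofCo {R : Type*} [CommRing R] (c : ℕ → R) : Jennings R :=
  ⟨PowerSeries.mk fun n => if n = 0 then 0 else if n = 1 then 1 else c (n - 1), by simp, by simp⟩

theorem co_ofCo {R : Type*} [CommRing R] (c : ℕ → R) {n : ℕ} (hn : 1 ≤ n) : co (ofCo c) n = c n := by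
  simp [co, ofCo, show n ≠ 0 by omega]

/-- At depth `2 * d` composition produces the cross term `(d + 1) * a * b`; subtracting `(d + 1)`
times a binomial coefficient absorbs it. -/
theorem add_mul_add_sub_one_ediv_two (a b : ℤ) :
    (a + b) * (a + b - 1) / 2 = a * (a - 1) / 2 + b * (b - 1) / 2 + a * b := by
  obtain ⟨x, hx⟩ := (Int.even_mul_pred_self a).two_dvd
  obtain ⟨y, hy⟩ := (Int.even_mul_pred_self b).two_dvd
  have : (a + b) * (a + b - 1) = 2 * (x + y + a * b) := by linear_combination hx + hy
  rw [this, hx, hy]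
  simp

/-- The free part of the abelianization of `V ℤ d`. -/
noncomputable def freePart (d : ℕ) (hd : 1 ≤ d) :
    level ℤ (d + 1) →* Multiplicative (Fin (d + 1) → ℤ) :=
  MonoidHom.mk' (fun f => Multiplicative.ofAdd fun i =>
    co f.1 (d + i) - if (i : ℕ) = d then (d + 1) * (co f.1 d * (co f.1 d - 1) / 2) else 0) (by
    intro f g
    rw [← ofAdd_add]
    congr 1
    funext i
    have hi := i.2
    have h1 : co (f.1 * g.1) d = co f.1 d + co g.1 d := co_mul_of_lt f.2 g.2 hd (by omega)
    simp only [Subgroup.coe_mul, Pi.add_apply]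
    split_ifs with h
    · have h2 := co_mul_of_lt_depth (r := 0) f.2 g.2 hd (by omega)
      simp only [Finset.sum_range_one, add_zero, zero_add, Nat.sub_self] at h2
      rw [h, h1, h2, add_mul_add_sub_one_ediv_two]
      push_cast
      ring
    · rw [co_mul_of_lt f.2 g.2 (by omega) (by omega)]
      ring)

theorem mem_ker_freePart {d : ℕ} (hd : 1 ≤ d) (f : level ℤ (d + 1)) :
    f ∈ (freePart d hd).ker ↔ f.1 ∈ V ℤ (2 * d + 1) := by
  rw [MonoidHom.mem_ker, mem_V]
  have key : freePart d hd f = 1 ↔ ∀ i : Fin (d + 1), co f.1 (d + i) -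
      (if (i : ℕ) = d then (d + 1) * (co f.1 d * (co f.1 d - 1) / 2) else 0) = 0 := by
    change Multiplicative.ofAdd (fun i : Fin (d + 1) => co f.1 (d + i) - if (i : ℕ) = d then
      (d + 1) * (co f.1 d * (co f.1 d - 1) / 2) else 0) = Multiplicative.ofAdd 0 ↔ _
    rw [Multiplicative.ofAdd.injective.eq_iff, funext_iff]
    rfl
  rw [key]
  constructor
  · intro h
    have h0 : co f.1 d = 0 := by
      have := h 0
      simpa [show (0 : ℕ) ≠ d by omega] using this
    intro i h1 h2
    rcases lt_or_ge i d with h3 | h3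
    · exact mem_V.1 f.2 i h1 h3
    · have := h ⟨i - d, by omega⟩
      simpa [h0, show d + (i - d) = i by omega] using this
  · intro h i
    have hi := i.2
    rw [h d hd (by omega), h (d + i) (by omega) (by omega)]
    simp

theorem freePart_surjective {d : ℕ} (hd : 1 ≤ d) : Function.Surjective (freePart d hd) := by
  intro y
  let z : Fin (d + 1) → ℤ := y.toAdd
  let c : ℕ → ℤ := fun n => if h : d ≤ n ∧ n < 2 * d + 1 then
    z ⟨n - d, by omega⟩ + (if n = 2 * d then (d + 1) * (z 0 * (z 0 - 1) / 2) else 0) else 0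
  have hc : ofCo c ∈ level ℤ (d + 1) := by
    refine mem_V.2 fun i h1 h2 => ?_
    rw [co_ofCo c h1]
    simp only [c]
    rw [dif_neg (by omega)]
  refine ⟨⟨ofCo c, hc⟩, ?_⟩
  change Multiplicative.ofAdd (fun i : Fin (d + 1) => co (ofCo c) (d + i) - if (i : ℕ) = d then
      (d + 1) * (co (ofCo c) d * (co (ofCo c) d - 1) / 2) else 0) = Multiplicative.ofAdd z
  congr 1
  have hd0 : c d = z 0 := by
    simp only [c]
    rw [dif_pos (by omega), if_neg (by omega)]
    simp
  funext i
  have hi := i.2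
  rw [co_ofCo c hd, co_ofCo c (by omega), hd0]
  simp only [c]
  rw [dif_pos (by omega)]
  have : (d + (i : ℕ) = 2 * d) = ((i : ℕ) = d) := by apply propext; omega
  simp [this]

/-- Since `V ℤ (2 * d + 1)` is the kernel of `freePart`, an invariant defined on it determines the
complement of the free part. -/
theorem nonempty_equiv_of_invariant {d : ℕ} (hd : 1 ≤ d) {T : Type*} [AddCommGroup T]
    (χ : Jennings ℤ → T)
    (hadd : ∀ f ∈ V ℤ (2 * d + 1), ∀ g ∈ V ℤ (2 * d + 1), χ (f * g) = χ f + χ g)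
    (hsurj : ∀ t, ∃ f ∈ V ℤ (2 * d + 1), χ f = t)
    (hker : ∀ f ∈ V ℤ (2 * d + 1), χ f = 0 ↔ f ∈ ⁅V ℤ d, V ℤ d⁆) :
    Nonempty (Additive (Abelianization (level ℤ (d + 1))) ≃+ (Fin (d + 1) → ℤ) × T) := by
  refine nonempty_abelianization_equiv_prod (freePart d hd) (freePart_surjective hd)
    (MonoidHom.mk' (fun f => Multiplicative.ofAdd (χ f.1.1)) ?_) ?_ ?_
  · intro f g
    rw [← ofAdd_add]
    exact congrArg _ (hadd _ ((mem_ker_freePart hd _).1 f.2) _ ((mem_ker_freePart hd _).1 g.2))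
  · intro t
    obtain ⟨f, hf, hft⟩ := hsurj t.toAdd
    refine ⟨⟨⟨f, V_anti (by omega) hf⟩, (mem_ker_freePart hd _).2 hf⟩, ?_⟩
    exact hft
  · intro f
    have h1 := hker f.1.1 ((mem_ker_freePart hd _).1 f.2)
    rw [← Subgroup.map_subtype_commutator] at h1
    exact h1.trans (Subgroup.mem_map_iff_mem (V ℤ d).subtype_injective (x := f.1))

/-! ### Commutators of the series `x + b x ^ (m + 1)`. -/

section General

variable {R : Type*} [CommRing R]

/-- Read off `⁅f, g⁆ * (g * f) = f * g` in the range where this product is additive on coefficients.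
-/
theorem co_commutator {f g : Jennings R} {a b e n : ℕ} (hf : f ∈ V R a) (hg : g ∈ V R b)
    (hw : g * f ∈ V R e) (hn : 1 ≤ n) (h : n < a + b + e) :
    co ⁅f, g⁆ n = co (f * g) n - co (g * f) n := by
  have h1 := co_mul_of_lt (commutator_mem hf hg) hw hn h
  rw [commutatorElement_def, mul_assoc (f * g), ← mul_inv_rev, inv_mul_cancel_right] at h1
  rw [h1, commutatorElement_def, mul_assoc (f * g), ← mul_inv_rev]
  ring

/-- The series `x + b x ^ (m + 1)`. -/
def mono (m : ℕ) (b : R) : Jennings R := ofCo fun n => if n = m then b else 0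

theorem co_mono (m : ℕ) (b : R) {n : ℕ} (hn : 1 ≤ n) : co (mono m b) n = if n = m then b else 0 :=
  co_ofCo _ hn

theorem mono_mem (m : ℕ) (b : R) : mono m b ∈ V R m :=
  mem_V.2 fun i h1 h2 => by rw [co_mono m b h1, if_neg (by omega)]

/-- The commutator of `x + x ^ (m + 1)` and `x + b x ^ (n + 1)`. -/
noncomputable abbrev br (m n : ℕ) (b : R) : Jennings R := ⁅(mono m 1 : Jennings R), mono n b⁆

variable {m n : ℕ} (b : R)

theorem co_mono_mul_mono (hm : 1 ≤ m) {r : ℕ} (hr : r < n) :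
    co (mono m 1 * mono n b) (m + n + r) =
      co (mono m (1 : R)) (m + n + r) + co (mono n b) (m + n + r) +
        if r = 0 then (m + 1 : ℕ) * b else 0 := by
  rw [co_mul_of_lt_depth (mono_mem m 1) (mono_mem n b) hm hr, Finset.sum_range_succ',
    Finset.sum_eq_zero]
  · rw [add_zero m, co_mono m _ hm, co_mono n _ (by omega : 1 ≤ n + (r - 0))]
    simp
  · intro i _
    rw [co_mono m _ (by omega), if_neg (by omega)]
    simp

theorem co_mono_mul_mono' (hm : 1 ≤ m) (hn : 1 ≤ n) {r : ℕ} (hr : r < 2 * m) :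
    co (mono n b * mono m 1) (n + m + r) =
      co (mono n b) (n + m + r) + co (mono m (1 : R)) (n + m + r) +
        if r = 0 then (n + 1 : ℕ) * b else if r = m then (n + 1).choose 2 * b else 0 := by
  rw [co_mul (mono_mem n b) (mono_mem m 1) hn hm hr, Finset.sum_range_succ',
    Finset.sum_eq_zero, zero_add]
  · congr 1
    rw [co_mono n _ (by omega), co_mono m _ (by omega : 1 ≤ m + (r - 0))]
    simp only [add_zero, if_true, Nat.sub_zero]
    rcases lt_or_ge r m with h | h
    · rw [coeff_tl_sq_of_lt (mono_mem m 1) (by omega)]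
      by_cases h0 : r = 0
      · simp [h0, mul_comm]
      · simp [h0, h.ne]
    · obtain ⟨s, rfl⟩ := Nat.exists_eq_add_of_le h
      rw [if_neg (by omega : ¬ m + (m + s) = m)]
      rw [show m + (m + s) = 2 * m + s by ring, coeff_tl_sq hm (mono_mem m 1), Finset.sum_range_succ',
        Finset.sum_eq_zero, co_mono m _ (by omega), co_mono m _ (by omega),
        if_neg (by omega : ¬ m + s = 0)]
      · by_cases h0 : s = 0
        · simp [h0, mul_comm]
        · simp [h0]
      · intro i _
        rw [co_mono m _ (by omega), if_neg (by omega), zero_mul]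
  · intro i _
    rw [co_mono n _ (by omega), if_neg (by omega)]
    simp

theorem mono_mul_mono_mem (h : m ≤ n) : mono n b * mono m 1 ∈ V R m :=
  mul_mem (V_anti h (mono_mem n b)) (mono_mem m 1)

theorem commutator_mono_mem : br m n b ∈ V R (m + n) :=
  commutator_mem (mono_mem m 1) (mono_mem n b)

theorem co_commutator_mono (hm : 1 ≤ m) (hmn : m ≤ n) :
    co (br m n b) (m + n) = ((m : R) - n) * b := by
  rw [co_commutator (mono_mem m 1) (mono_mem n b) (mono_mul_mono_mem b hmn) (by omega) (by omega)]
  have h1 := co_mono_mul_mono (m := m) (n := n) b hm (r := 0) (by omega)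
  have h2 := co_mono_mul_mono' (m := m) (n := n) b hm (by omega) (r := 0) (by omega)
  rw [add_zero, if_pos rfl] at h1 h2
  rw [h1, add_comm m n, h2]
  push_cast
  ring

theorem co_commutator_mono_of_lt (hm : 1 ≤ m) (hmn : m ≤ n) {N : ℕ} (h1 : m + n < N)
    (h2 : N < n + 2 * m) : co (br m n b) N = 0 := by
  obtain ⟨r, rfl⟩ := Nat.exists_eq_add_of_le h1.le
  rw [co_commutator (mono_mem m 1) (mono_mem n b) (mono_mul_mono_mem b hmn) (by omega) (by omega),
    co_mono_mul_mono b hm (by omega), add_comm m n, co_mono_mul_mono' b hm (by omega) (by omega),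
    if_neg (by omega), if_neg (by omega), if_neg (by omega)]
  ring

/-- From depth `n + 2 * m` on, the product `⁅f, g⁆ * (g * f)` is no longer additive; the sum is its
first-order correction. -/
theorem co_mul_commutator_mono (hmn : m < n) {r : ℕ} (hr : r < m) :
    co (br m n b) (n + 2 * m + r) =
      co (mono m 1 * mono n b) (m + n + (m + r)) - co (mono n b * mono m 1) (n + m + (m + r)) -
      ∑ i ∈ Finset.range (r + 1), (m + n + i + 1 : ℕ) * (co (br m n b) (m + n + i) *
        co (mono n b * mono m 1) (m + (r - i))) := by
  have h1 := co_mul_of_lt_depth (commutator_mono_mem (m := m) (n := n) b)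
    (mono_mul_mono_mem b hmn.le) (by omega) hr
  have h2 : br m n b * (mono n b * mono m 1) = mono m 1 * mono n b := by
    rw [br, commutatorElement_def, mul_assoc (mono m 1 * mono n b), ← mul_inv_rev, inv_mul_cancel_right]
  rw [h2] at h1
  rw [show m + n + (m + r) = m + n + m + r by ring, h1,
    show n + m + (m + r) = m + n + m + r by ring, show n + 2 * m + r = m + n + m + r by ring]
  ring

/-- The binomial coefficient is the second-order term of `(1 + x ^ m) ^ (n + 1)`; the other summand
comes from composing the leading term with `g * f`. This is the source of odd coefficients at even
depths. -/
theorem co_commutator_mono_top (hm : 1 ≤ m) (hmn : m < n) :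
    co (br m n b) (n + 2 * m) =
      (((n : R) - m) * (n + m + 1) - (n + 1).choose 2) * b := by
  have h1 := co_mul_commutator_mono b hmn (r := 0) (by omega)
  have h3 : co (mono n b * mono m 1) m = 1 := by
    rw [co_mul_of_lt (mono_mem n b) (mono_mem m 1) hm (by omega), co_mono n _ hm, co_mono m _ hm,
      if_neg (by omega), if_pos rfl, zero_add]
  simp only [add_zero, zero_add, Finset.sum_range_one, Nat.sub_self] at h1
  rw [h1, co_commutator_mono b hm hmn.le, h3, co_mono_mul_mono b hm hmn,
    co_mono_mul_mono' b hm (by omega) (by omega), if_neg (by omega), if_neg (by omega), if_pos rfl,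
    add_comm m n]
  push_cast
  ring

theorem co_commutator_mono_top_succ (hm : 2 ≤ m) (hmn : m + 1 < n) :
    co (br m n b) (n + 2 * m + 1) = 0 := by
  have h3 : co (mono n b * mono m 1) (m + 1) = 0 := by
    rw [co_mul_of_lt (mono_mem n b) (mono_mem m 1) (by omega) (by omega), co_mono n _ (by omega),
      co_mono m _ (by omega), if_neg (by omega), if_neg (by omega), zero_add]
  rw [co_mul_commutator_mono b (by omega) (r := 1) (by omega), Finset.sum_range_succ,
    Finset.sum_range_one,
    co_commutator_mono_of_lt (N := m + n + 1) b (by omega) (by omega) (by omega) (by omega),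
    Nat.sub_zero, h3, co_mono_mul_mono b (by omega) (by omega),
    co_mono_mul_mono' b (by omega) (by omega) (by omega), if_neg (by omega), if_neg (by omega),
    if_neg (by omega), add_comm m n]
  ring

theorem co_mul_of_mem {f g : Jennings R} {a N : ℕ} (hf : f ∈ V R a) (hg : g ∈ V R a) (h1 : 1 ≤ N)
    (h : N < 2 * a) : co (f * g) N = co f N + co g N := co_mul_of_lt hf hg h1 (by omega)

theorem mem_V_succ {f : Jennings R} {n : ℕ} (hf : f ∈ V R n) (h : co f n = 0) : f ∈ V R (n + 1) :=
  mem_V.2 fun i h1 h2 => by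
    rcases Nat.lt_succ_iff_lt_or_eq.1 h2 with h3 | rfl
    · exact mem_V.1 hf i h1 h3
    · exact h

end General

/-! ### Leading coefficients realised in the commutator subgroup. -/

theorem odd_choose_two {n : ℕ} (hn : n % 4 = 2) : Odd (((n + 1).choose 2 : ℕ) : ℤ) := by
  obtain ⟨q, rfl⟩ : ∃ q, n = 4 * q + 2 := ⟨n / 4, by omega⟩
  have : (4 * q + 2 + 1).choose 2 = (4 * q + 3) * (2 * q + 1) := by
    rw [Nat.choose_two_right, show (4 * q + 2 + 1) * (4 * q + 2 + 1 - 1) =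
      ((4 * q + 3) * (2 * q + 1)) * 2 by rw [Nat.add_sub_cancel]; ring, Nat.mul_div_cancel _ two_pos]
  rw [this]
  exact ⟨(4 * q ^ 2 + 5 * q + 1 : ℤ), by push_cast; ring⟩

theorem odd_co_commutator_mono_top {m n : ℕ} {b : ℤ} (hm : 1 ≤ m) (hmn : m < n) (hn : n % 4 = 2)
    (hb : Odd b) : Odd (co (br m n b) (n + 2 * m)) := by
  rw [co_commutator_mono_top b hm hmn]
  refine Odd.mul (Even.sub_odd ?_ (odd_choose_two hn)) hb
  rcases Nat.even_or_odd m with h | h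
  · refine Even.mul_right (Even.sub ?_ (by exact_mod_cast h)) _
    exact_mod_cast (Nat.even_iff.2 (by omega) : Even n)
  · refine Even.mul_left ?_ _
    have : Odd n → False := fun h => by rw [Nat.odd_iff] at h; omega
    exact_mod_cast (show Even (n + m + 1) by rw [Nat.even_iff]; rw [Nat.odd_iff] at h; omega)

/-- The leading term of `[e_m, e_n]` is cancelled by the two following commutators, and the next
term has an odd coefficient. -/
theorem commutator_triple {m n : ℕ} (hm : 1 ≤ m) (hmn : m + 4 ≤ n) (hn : n % 4 = 2) :
    br m n (1 : ℤ) * br (m + 1) (n - 1) (-2) * br (m + 2) (n - 2) 1 ∈ V ℤ (n + 2 * m) ∧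
      Odd (co (br m n (1 : ℤ) * br (m + 1) (n - 1) (-2) * br (m + 2) (n - 2) 1) (n + 2 * m)) := by
  set c1 : Jennings ℤ := br m n 1 with hc1
  set c2 : Jennings ℤ := br (m + 1) (n - 1) (-2) with hc2
  set c3 : Jennings ℤ := br (m + 2) (n - 2) 1 with hc3
  have h1 : c1 ∈ V ℤ (m + n) := commutator_mono_mem _
  have h2 : c2 ∈ V ℤ (m + n) := by
    have := commutator_mono_mem (m := m + 1) (n := n - 1) (-2 : ℤ)
    rwa [show m + 1 + (n - 1) = m + n by omega] at this
  have h3 : c3 ∈ V ℤ (m + n) := by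
    have := commutator_mono_mem (m := m + 2) (n := n - 2) (1 : ℤ)
    rwa [show m + 2 + (n - 2) = m + n by omega] at this
  have hsum : ∀ N, 1 ≤ N → N < 2 * (m + n) → co (c1 * c2 * c3) N = co c1 N + co c2 N + co c3 N := by
    intro N h h'
    rw [co_mul_of_mem (mul_mem h1 h2) h3 h h', co_mul_of_mem h1 h2 h h']
  have e2 : ∀ N, m + n < N → N < n + 2 * m + 1 → co c2 N = 0 := fun N h h' =>
    co_commutator_mono_of_lt _ (by omega) (by omega) (by omega) (by omega)
  have e3 : ∀ N, m + n < N → N < n + 2 * m + 1 → co c3 N = 0 := fun N h h' =>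
    co_commutator_mono_of_lt _ (by omega) (by omega) (by omega) (by omega)
  constructor
  · rw [mem_V]
    intro N hN hN'
    rcases lt_trichotomy N (m + n) with h | h | h
    · exact mem_V.1 (mul_mem (mul_mem h1 h2) h3) N hN h
    · rw [hsum N hN (by omega), h, hc1, co_commutator_mono _ hm (by omega)]
      have t2 := co_commutator_mono (m := m + 1) (n := n - 1) (-2 : ℤ) (by omega) (by omega)
      have t3 := co_commutator_mono (m := m + 2) (n := n - 2) (1 : ℤ) (by omega) (by omega)
      rw [show m + 1 + (n - 1) = m + n by omega] at t2
      rw [show m + 2 + (n - 2) = m + n by omega] at t3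
      rw [hc2, hc3, t2, t3]
      push_cast [Nat.cast_sub (show 1 ≤ n by omega), Nat.cast_sub (show 2 ≤ n by omega)]
      ring
    · rw [hsum N hN (by omega), e2 N h (by omega), e3 N h (by omega), hc1,
        co_commutator_mono_of_lt _ hm (by omega) h hN']
      simp
  · rw [hsum _ (by omega) (by omega), e2 _ (by omega) (by omega), e3 _ (by omega) (by omega),
      add_zero, add_zero]
    exact odd_co_commutator_mono_top hm (by omega) hn odd_one

/-- The leading coefficients at depth `N` of elements of the commutator subgroup of `V ℤ d`. -/
noncomputable def leads (d N : ℕ) (hN : 1 ≤ N) : AddSubgroup ℤ where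
  carrier := {a | ∃ z ∈ ⁅V ℤ d, V ℤ d⁆, z ∈ V ℤ N ∧ co z N = a}
  zero_mem' := ⟨1, one_mem _, one_mem _, by
    have := coeff_X (R := ℤ) (N + 1)
    rw [if_neg (by omega)] at this
    exact this⟩
  add_mem' := by
    rintro _ _ ⟨z, h1, h2, rfl⟩ ⟨w, h3, h4, rfl⟩
    exact ⟨z * w, mul_mem h1 h3, mul_mem h2 h4, co_mul_of_mem h2 h4 hN (by omega)⟩
  neg_mem' := by
    rintro _ ⟨z, h1, h2, rfl⟩
    refine ⟨z⁻¹, inv_mem h1, inv_mem h2, ?_⟩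
    have h := co_mul_of_mem h2 (inv_mem h2) hN (by omega)
    have h0 : co (1 : Jennings ℤ) N = 0 := by
      have := coeff_X (R := ℤ) (N + 1)
      rwa [if_neg (by omega)] at this
    rw [mul_inv_cancel, h0] at h
    linarith

theorem commutator_mono_mem_commutator {d m n : ℕ} (hm : d ≤ m) (hn : d ≤ n) (a b : ℤ) :
    ⁅mono m a, mono n b⁆ ∈ ⁅V ℤ d, V ℤ d⁆ :=
  Subgroup.commutator_mem_commutator (V_anti hm (mono_mem m a)) (V_anti hn (mono_mem n b))

theorem sub_mem_leads {d m n : ℕ} (hd : 1 ≤ d) (hm : d ≤ m) (hmn : m ≤ n) :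
    (m : ℤ) - n ∈ leads d (m + n) (by omega) :=
  ⟨br m n 1, commutator_mono_mem_commutator hm (by omega) _ _, commutator_mono_mem _, by
    rw [co_commutator_mono _ (by omega) hmn, mul_one]⟩

/-- Adjacent indices `i`, `i + 1` give the leading coefficient `-1`. -/
theorem leads_of_odd {d N : ℕ} (hd : 1 ≤ d) (hN : 2 * d + 1 ≤ N) (h : Odd N) (a : ℤ) :
    a ∈ leads d N (by omega) := by
  obtain ⟨i, rfl⟩ := h
  have h1 := sub_mem_leads (m := i) (n := i + 1) hd (by omega) (by omega)
  have h2 := (leads d (i + (i + 1)) (by omega)).zsmul_mem h1 (-a)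
  have h3 : (-a) • ((i : ℤ) - (i + 1 : ℕ)) = a := by push_cast; ring
  rw [h3] at h2
  simpa only [show i + (i + 1) = 2 * i + 1 by ring] using h2

/-- Indices differing by 2 give the leading coefficient `-2`. -/
theorem leads_of_even {d N : ℕ} (hd : 1 ≤ d) (hN : 2 * d + 2 ≤ N) (h : Even N) {a : ℤ} (ha : Even a) :
    a ∈ leads d N (by omega) := by
  obtain ⟨i, rfl⟩ := h
  obtain ⟨j, rfl⟩ : ∃ j, i = j + 1 := ⟨i - 1, by omega⟩
  obtain ⟨c, rfl⟩ := ha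
  have h1 := sub_mem_leads (m := j) (n := j + 2) hd (by omega) (by omega)
  have h2 := (leads d (j + (j + 2)) (by omega)).zsmul_mem h1 (-c)
  have h3 : (-c) • ((j : ℤ) - (j + 2 : ℕ)) = c + c := by push_cast; ring
  rw [h3] at h2
  simpa only [show j + (j + 2) = j + 1 + (j + 1) by ring] using h2

theorem leads_of_exists_odd {d N : ℕ} (hd : 1 ≤ d) (hN : 2 * d + 1 ≤ N)
    (h : ∃ c ∈ leads d N (by omega), Odd c) (a : ℤ) : a ∈ leads d N (by omega) := by
  rcases Nat.even_or_odd N with hN' | hN'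
  · obtain ⟨c, hc, hc'⟩ := h
    have hN2 : 2 * d + 2 ≤ N := by
      obtain ⟨i, rfl⟩ := hN'
      omega
    rcases Int.even_or_odd a with ha | ha
    · exact leads_of_even hd hN2 hN' ha
    · have := add_mem hc (leads_of_even hd hN2 hN' (ha.sub_odd hc'))
      rwa [add_sub_cancel] at this
  · exact leads_of_odd hd hN hN' a

theorem leads_of_mod_four {d m n : ℕ} (hd : 1 ≤ d) (hm : d ≤ m) (hmn : m + 3 ≤ n) (hn : n % 4 = 2)
    (a : ℤ) : a ∈ leads d (n + 2 * m) (by omega) := by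
  refine leads_of_exists_odd hd (by omega) ?_ a
  -- For `n = m + 3` the triple would end in `[e_{m+2}, e_{m+1}]`, so two commutators are used
  -- instead: their leading terms are `-3` and `(-3) * (-1)`.
  rcases Nat.eq_or_lt_of_le hmn with h | h
  · subst h
    set c1 : Jennings ℤ := br m (m + 3) 1 with hc1
    set c2 : Jennings ℤ := br (m + 1) (m + 2) (-3) with hc2
    have h1 : c1 ∈ V ℤ (m + (m + 3)) := commutator_mono_mem _
    have h2 : c2 ∈ V ℤ (m + (m + 3)) := by
      have := commutator_mono_mem (m := m + 1) (n := m + 2) (-3 : ℤ)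
      rwa [show m + 1 + (m + 2) = m + (m + 3) by omega] at this
    have hsum := fun N (h : 1 ≤ N) h' => co_mul_of_mem (N := N) h1 h2 h h'
    have e2 : ∀ N, m + (m + 3) < N → N < m + 3 + 2 * m + 1 → co c2 N = 0 := fun N h h' =>
      co_commutator_mono_of_lt _ (by omega) (by omega) (by omega) (by omega)
    refine ⟨_, ⟨c1 * c2, mul_mem (commutator_mono_mem_commutator hm (by omega) _ _)
      (commutator_mono_mem_commutator (by omega) (by omega) _ _), mem_V.2 fun N hN hN' => ?_, rfl⟩, ?_⟩
    · rcases lt_trichotomy N (m + (m + 3)) with h | h | h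
      · exact mem_V.1 (mul_mem h1 h2) N hN h
      · have t2 := co_commutator_mono (m := m + 1) (n := m + 2) (-3 : ℤ) (by omega) (by omega)
        rw [show m + 1 + (m + 2) = m + (m + 3) by omega] at t2
        rw [hsum N hN (by omega), h, hc1, co_commutator_mono _ (by omega) (by omega), hc2, t2]
        push_cast
        ring
      · rw [hsum N hN (by omega), e2 N h (by omega), hc1,
          co_commutator_mono_of_lt _ (by omega) (by omega) h hN', zero_add]
    · rw [hsum _ (by omega) (by omega), e2 _ (by omega) (by omega), add_zero]
      exact odd_co_commutator_mono_top (by omega) (by omega) hn odd_one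
  · obtain ⟨h1, h2⟩ := commutator_triple (m := m) (n := n) (by omega) (by omega) hn
    exact ⟨_, ⟨_, mul_mem (mul_mem (commutator_mono_mem_commutator hm (by omega) _ _)
      (commutator_mono_mem_commutator (by omega) (by omega) _ _))
      (commutator_mono_mem_commutator (by omega) (by omega) _ _), h1, rfl⟩, h2⟩

/-- The odd term comes from `[e_{d+1}, e_{d+2}]`, whose indices are too close for an inner pair to
cancel its leading term. The outer pair `d`, `d + 3` does so, but leaves a term at depth `3 * d +
3`, which the odd-depth commutator `c3` removes; neither contributes at depth `3 * d + 4`. -/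
theorem leads_three_mul_add_four {d : ℕ} (hd : 1 ≤ d) (h4 : d % 4 = 0) (a : ℤ) :
    a ∈ leads d (3 * d + 4) (by omega) := by
  refine leads_of_exists_odd hd (by omega) ?_ a
  set c1 : Jennings ℤ := br (d + 1) (d + 2) 3 with hc1
  set c2 : Jennings ℤ := br d (d + 3) (-1) with hc2
  obtain ⟨i, hi⟩ : ∃ i, 2 * i + 1 = 3 * d + 3 := ⟨3 * d / 2 + 1, by omega⟩
  set c3 : Jennings ℤ := br i (i + 1) (co c2 (3 * d + 3)) with hc3
  have h1 : c1 ∈ V ℤ (2 * d + 3) := by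
    have := commutator_mono_mem (m := d + 1) (n := d + 2) (3 : ℤ)
    rwa [show d + 1 + (d + 2) = 2 * d + 3 by omega] at this
  have h2 : c2 ∈ V ℤ (2 * d + 3) := by
    have := commutator_mono_mem (m := d) (n := d + 3) (-1 : ℤ)
    rwa [show d + (d + 3) = 2 * d + 3 by omega] at this
  have h3 : c3 ∈ V ℤ (3 * d + 3) := by
    have := commutator_mono_mem (m := i) (n := i + 1) (co c2 (3 * d + 3))
    rwa [show i + (i + 1) = 3 * d + 3 by omega] at this
  have h3' := V_anti (show 2 * d + 3 ≤ 3 * d + 3 by omega) h3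
  have hsum : ∀ N, 1 ≤ N → N < 2 * (2 * d + 3) → co (c1 * c2 * c3) N = co c1 N + co c2 N + co c3 N := by
    intro N h h'
    rw [co_mul_of_mem (mul_mem h1 h2) h3' h h', co_mul_of_mem h1 h2 h h']
  have e1 : ∀ N, 2 * d + 3 < N → N < 3 * d + 4 → co c1 N = 0 := fun N h h' =>
    co_commutator_mono_of_lt _ (by omega) (by omega) (by omega) (by omega)
  refine ⟨_, ⟨c1 * c2 * c3, mul_mem (mul_mem (commutator_mono_mem_commutator (by omega) (by omega) _ _)
      (commutator_mono_mem_commutator (by omega) (by omega) _ _))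
      (commutator_mono_mem_commutator (by omega) (by omega) _ _), mem_V.2 fun N hN hN' => ?_, rfl⟩, ?_⟩
  · rcases lt_trichotomy N (2 * d + 3) with h | h | h
    · exact mem_V.1 (mul_mem (mul_mem h1 h2) h3') N hN h
    · have t1 := co_commutator_mono (m := d + 1) (n := d + 2) (3 : ℤ) (by omega) (by omega)
      have t2 := co_commutator_mono (m := d) (n := d + 3) (-1 : ℤ) (by omega) (by omega)
      rw [show d + 1 + (d + 2) = 2 * d + 3 by omega] at t1
      rw [show d + (d + 3) = 2 * d + 3 by omega] at t2
      rw [hsum N hN (by omega), h, mem_V.1 h3 _ (by omega) (by omega), hc1, hc2, t1, t2]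
      push_cast
      ring
    · rw [hsum N hN (by omega), e1 N h (by omega)]
      rcases Nat.lt_succ_iff_lt_or_eq.1 (show N < (3 * d + 3) + 1 by omega) with h' | rfl
      · rw [mem_V.1 h3 _ hN h', hc2, co_commutator_mono_of_lt _ hd (by omega) (by omega) (by omega)]
        simp
      · have t3 := co_commutator_mono (m := i) (n := i + 1) (co c2 (3 * d + 3)) (by omega) (by omega)
        rw [show i + (i + 1) = 3 * d + 3 by omega] at t3
        rw [hc3, t3]
        push_cast
        ring
  · have t1 := odd_co_commutator_mono_top (m := d + 1) (n := d + 2) (b := 3) (by omega) (by omega)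
      (by omega) (by decide)
    have t2 := co_commutator_mono_top_succ (m := d) (n := d + 3) (-1 : ℤ) (by omega) (by omega)
    rw [show d + 2 + 2 * (d + 1) = 3 * d + 4 by omega] at t1
    rw [show d + 3 + 2 * d + 1 = 3 * d + 4 by omega] at t2
    have t3 := co_commutator_mono_of_lt (m := i) (n := i + 1) (co c2 (3 * d + 3)) (N := 3 * d + 4)
      (by omega) (by omega) (by omega) (by omega)
    rw [hsum _ (by omega) (by omega), hc2, t2, hc3, t3, add_zero, add_zero]
    exact t1

end Jennings

/-! ### Deep series are products of four commutators. -/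

section Word

open scoped commutatorElement

variable {G : Type*} [Group G]

/-- The product of the commutators `[g i, u i]`. -/
def commWord (g u : Fin 4 → G) : G := ⁅g 0, u 0⁆ * ⁅g 1, u 1⁆ * ⁅g 2, u 2⁆ * ⁅g 3, u 3⁆

/-- This rests on `[g, v u] = [g, v] · v [g, u] v⁻¹`; the hypotheses remove the conjugation and
allow the factors to be regrouped. -/
theorem commWord_mul {g u v : Fin 4 → G} (h1 : ∀ i, Commute (v i) ⁅g i, u i⁆)
    (h2 : ∀ i j, Commute ⁅g i, v i⁆ ⁅g j, u j⁆) :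
    commWord g (v * u) = commWord g v * commWord g u := by
  have h : ∀ i, ⁅g i, (v * u) i⁆ = ⁅g i, v i⁆ * ⁅g i, u i⁆ := by
    intro i
    have e : ⁅g i, (v * u) i⁆ = ⁅g i, v i⁆ * (v i * ⁅g i, u i⁆ * (v i)⁻¹) := by
      simp only [commutatorElement_def, Pi.mul_apply]
      group
    rw [e, (h1 i).eq, mul_inv_cancel_right]
  simp only [commWord, h]
  rw [((h2 1 0).symm).mul_mul_mul_comm,
    (((h2 2 0).symm).mul_left ((h2 2 1).symm)).mul_mul_mul_comm,
    ((((h2 3 0).symm).mul_left ((h2 3 1).symm)).mul_left ((h2 3 2).symm)).mul_mul_mul_comm]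

theorem map_commWord {H : Type*} [Group H] (φ : G →* H) (g u : Fin 4 → G) :
    φ (commWord g u) = commWord (φ ∘ g) (φ ∘ u) := by
  simp [commWord, map_commutatorElement]

end Word

namespace Jennings

open PowerSeries
open scoped commutatorElement

section

variable {R : Type*} [CommRing R]

theorem mk_eq_mk {f g : Jennings R} {n : ℕ} :
    (QuotientGroup.mk' (V R n) f = QuotientGroup.mk' (V R n) g) ↔ ∀ i < n, co f i = co g i := by
  rw [QuotientGroup.mk'_apply, QuotientGroup.mk'_apply, QuotientGroup.eq_iff_div_mem, div_eq_mul_inv,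
    mul_inv_mem_V]

theorem mk_eq_one {f : Jennings R} {n : ℕ} (hf : f ∈ V R n) : QuotientGroup.mk' (V R n) f = 1 := by
  rwa [← MonoidHom.mem_ker, QuotientGroup.ker_mk']

theorem commute_mk {f g : Jennings R} {a b n : ℕ} (hf : f ∈ V R a) (hg : g ∈ V R b) (h : n ≤ a + b) :
    Commute (QuotientGroup.mk' (V R n) f) (QuotientGroup.mk' (V R n) g) := by
  rw [← commutatorElement_eq_one_iff_commute, ← map_commutatorElement]
  exact mk_eq_one (V_anti h (commutator_mem hf hg))

theorem commWord_mul_congr {g u v : Fin 4 → Jennings R} {d p q n : ℕ} (hg : ∀ i, g i ∈ V R d)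
    (hv : ∀ i, v i ∈ V R p) (hu : ∀ i, u i ∈ V R q) (hn : n ≤ p + q + d) :
    QuotientGroup.mk' (V R n) (commWord g (v * u)) =
      QuotientGroup.mk' (V R n) (commWord g v * commWord g u) := by
  rw [map_mul, map_commWord, map_commWord, map_commWord, ← commWord_mul]
  · congr 1
  · intro i
    rw [Function.comp_apply, Function.comp_apply, Function.comp_apply, ← map_commutatorElement]
    exact commute_mk (hv i) (commutator_mem (hg i) (hu i)) (by omega)
  · intro i j
    simp only [Function.comp_apply]
    rw [← map_commutatorElement, ← map_commutatorElement]
    exact commute_mk (commutator_mem (hg i) (hv i)) (commutator_mem (hg j) (hu j)) (by omega)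

theorem exists_limit {w : ℕ → Jennings R} {q : ℕ} (hq : 1 ≤ q)
    (hw : ∀ s, ∀ i < s + q, co (w (s + 1)) i = co (w s) i) :
    ∃ x : Jennings R, ∀ s, ∀ i < s + q, co x i = co (w s) i := by
  have hst : ∀ s t, ∀ i < s + q, co (w (s + t)) i = co (w s) i := by
    intro s t i hi
    induction t with
    | zero => rfl
    | succ t ih => rw [← add_assoc, hw _ i (by omega), ih]
  refine ⟨ofCo fun n => co (w n) n, fun s i hi => ?_⟩
  rcases Nat.eq_zero_or_pos i with rfl | h
  · simp
  · rw [co_ofCo _ h]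
    rcases le_total i s with h' | h'
    · obtain ⟨t, rfl⟩ := Nat.exists_eq_add_of_le h'
      exact (hst i t i (by omega)).symm
    · obtain ⟨t, rfl⟩ := Nat.exists_eq_add_of_le h'
      exact hst s t _ hi

end

/-- The series `x + x ^ (d + i + 1)`, `i < 4`. -/
noncomputable def gens (d : ℕ) (i : Fin 4) : Jennings ℤ := mono (d + i) 1

theorem gens_mem (d : ℕ) (i : Fin 4) : gens d i ∈ V ℤ d := V_anti (by omega) (mono_mem _ _)

/-- The realisable values are closed under addition by `commWord_mul_congr`, so a few generating
values suffice. The bound `N - 2 * d - 4` is the smallest index paired with a generator. -/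
theorem exists_commWord {d N : ℕ} (hd : 1 ≤ d) (hN : 10 * d + 20 ≤ N) (a : ℤ) :
    ∃ u : Fin 4 → Jennings ℤ, (∀ i, u i ∈ V ℤ (N - 2 * d - 4)) ∧ commWord (gens d) u ∈ V ℤ N ∧
      co (commWord (gens d) u) N = a := by
  let S : Set ℤ := {a | ∃ u : Fin 4 → Jennings ℤ, (∀ i, u i ∈ V ℤ (N - 2 * d - 4)) ∧
    commWord (gens d) u ∈ V ℤ N ∧ co (commWord (gens d) u) N = a}
  have hadd : ∀ a ∈ S, ∀ b ∈ S, a + b ∈ S := by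
    rintro _ ⟨v, h1, h2, rfl⟩ _ ⟨u, h3, h4, rfl⟩
    have h := mk_eq_mk.1 (commWord_mul_congr (gens_mem d) h1 h3 (n := N + 1) (by omega))
    refine ⟨v * u, fun i => mul_mem (h1 i) (h3 i), mem_V.2 fun i hi hi' => ?_, ?_⟩
    · rw [h i (by omega)]
      exact mem_V.1 (mul_mem h2 h4) i hi hi'
    · rw [h N (by omega), co_mul_of_mem h2 h4 (by omega) (by omega)]
  have hmono : ∀ (n : ℕ) (b : ℤ), N - 2 * d - 4 ≤ n → mono n b ∈ V ℤ (N - 2 * d - 4) :=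
    fun n b h => V_anti h (mono_mem n b)
  have hbr : ∀ m n b, m + n = N → br m n b ∈ V ℤ N := by
    rintro m n b rfl
    exact commutator_mono_mem b
  have hS0 : ∀ b : ℤ, (2 * d - N) * b ∈ S := by
    intro b
    have e : commWord (gens d) ![mono (N - d) b, 1, 1, 1] = br d (N - d) b := by
      simp [commWord, gens]
    refine ⟨![mono (N - d) b, 1, 1, 1], ?_, ?_, ?_⟩
    · intro i
      fin_cases i
      · exact hmono _ _ (by omega)
      all_goals exact one_mem _
    · rw [e]; exact hbr _ _ _ (by omega)
    · have := co_commutator_mono (m := d) (n := N - d) b hd (by omega)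
      rw [show d + (N - d) = N by omega] at this
      rw [e, this, Nat.cast_sub (by omega)]
      ring
  have hS1 : ∀ b : ℤ, (2 * d + 2 - N) * b ∈ S := by
    intro b
    have e : commWord (gens d) ![1, mono (N - d - 1) b, 1, 1] = br (d + 1) (N - d - 1) b := by
      simp [commWord, gens]
    refine ⟨![1, mono (N - d - 1) b, 1, 1], ?_, ?_, ?_⟩
    · intro i
      fin_cases i
      · exact one_mem _
      · exact hmono _ _ (by omega)
      all_goals exact one_mem _
    · rw [e]; exact hbr _ _ _ (by omega)
    · have := co_commutator_mono (m := d + 1) (n := N - d - 1) b (by omega) (by omega)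
      rw [show d + 1 + (N - d - 1) = N by omega] at this
      rw [e, this, Nat.sub_sub, Nat.cast_sub (by omega)]
      push_cast
      ring
  change a ∈ S
  rcases Nat.even_or_odd N with he | ho
  · have heven : ∀ c : ℤ, Even c → c ∈ S := by
      rintro _ ⟨c, rfl⟩
      have := hadd _ (hS0 (-c)) _ (hS1 c)
      rwa [show (2 * d - N : ℤ) * (-c) + (2 * d + 2 - N) * c = c + c by ring] at this
    have hodd : ∃ c ∈ S, Odd c := by
      rw [Nat.even_iff] at he
      -- The odd value needs three consecutive generators, starting at `d` or at `d + 1` according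
      -- to `N` modulo 4; hence four generators in all.
      rcases (by omega : (N - 2 * d) % 4 = 2 ∨ (N - 2 * d - 2) % 4 = 2) with h | h
      · obtain ⟨h1, h2⟩ := commutator_triple (m := d) (n := N - 2 * d) hd (by omega) h
        rw [show N - 2 * d + 2 * d = N by omega] at h1 h2
        have e : commWord (gens d) ![mono (N - 2 * d) 1, mono (N - 2 * d - 1) (-2),
            mono (N - 2 * d - 2) 1, 1] = br d (N - 2 * d) 1 *
            br (d + 1) (N - 2 * d - 1) (-2) * br (d + 2) (N - 2 * d - 2) 1 := by
          simp [commWord, gens]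
        rw [← e] at h1 h2
        refine ⟨_, ⟨_, ?_, h1, rfl⟩, h2⟩
        intro i
        fin_cases i
        · exact hmono _ _ (by omega)
        · exact hmono _ _ (by omega)
        · exact hmono _ _ (by omega)
        · exact one_mem _
      · obtain ⟨h1, h2⟩ := commutator_triple (m := d + 1) (n := N - 2 * d - 2) (by omega) (by omega) h
        rw [show N - 2 * d - 2 + 2 * (d + 1) = N by omega] at h1 h2
        have e : commWord (gens d) ![1, mono (N - 2 * d - 2) 1, mono (N - 2 * d - 2 - 1) (-2),
            mono (N - 2 * d - 2 - 2) 1] = br (d + 1) (N - 2 * d - 2) 1 *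
            br (d + 1 + 1) (N - 2 * d - 2 - 1) (-2) * br (d + 1 + 2) (N - 2 * d - 2 - 2) 1 := by
          simp [commWord, gens, add_assoc]
        rw [← e] at h1 h2
        refine ⟨_, ⟨_, ?_, h1, rfl⟩, h2⟩
        intro i
        fin_cases i
        · exact one_mem _
        · exact hmono _ _ (by omega)
        · exact hmono _ _ (by omega)
        · exact hmono _ _ (by omega)
    obtain ⟨c, hc, hc'⟩ := hodd
    rcases Int.even_or_odd a with ha | ha
    · exact heven a ha
    · have := hadd _ hc _ (heven _ (ha.sub_odd hc'))
      rwa [add_sub_cancel] at this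
  · obtain ⟨t, ht⟩ : ∃ t, N = 2 * d + (2 * t + 1) := by
      obtain ⟨i, hi⟩ := ho
      exact ⟨i - d, by omega⟩
    -- A Bézout relation between the coprime leading coefficients `-(2 * t + 1)` and `-(2 * t - 1)`.
    have := hadd _ (hS0 ((t - 1) * a)) _ (hS1 (-t * a))
    rw [ht] at this
    push_cast at this
    rwa [show (2 * d - (2 * d + (2 * t + 1)) : ℤ) * ((t - 1) * a) +
      (2 * d + 2 - (2 * d + (2 * t + 1))) * (-t * a) = a by ring] at this

/-- One step of successive approximation: the error at depth `N` is absorbed by multiplying `u` by a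
deep `v`, so the arguments change only from depth `N - 2 * d - 4` on. -/
theorem exists_commWord_step {d N : ℕ} (hd : 1 ≤ d) (hN : 10 * d + 20 ≤ N) {h : Jennings ℤ}
    {u : Fin 4 → Jennings ℤ} (hu : ∀ i, u i ∈ V ℤ (2 * d + 4))
    (he : ∀ i < N, co h i = co (commWord (gens d) u) i) :
    ∃ u' : Fin 4 → Jennings ℤ, (∀ i, u' i ∈ V ℤ (2 * d + 4)) ∧
      (∀ i < N + 1, co h i = co (commWord (gens d) u') i) ∧
      ∀ j, ∀ i < N - 2 * d - 4, co (u' j) i = co (u j) i := by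
  set e := h * (commWord (gens d) u)⁻¹ with hedef
  have heV : e ∈ V ℤ N := mul_inv_mem_V.2 he
  obtain ⟨v, hv, hvN, hva⟩ := exists_commWord hd hN (co e N)
  refine ⟨v * u, fun i => mul_mem (V_anti (by omega) (hv i)) (hu i), ?_, ?_⟩
  · rw [← mk_eq_mk, commWord_mul_congr (gens_mem d) hv hu (by omega), map_mul]
    have h1 : QuotientGroup.mk' (V ℤ (N + 1)) e = QuotientGroup.mk' (V ℤ (N + 1)) (commWord (gens d) v) := by
      rw [mk_eq_mk]
      intro i hi
      rcases Nat.eq_zero_or_pos i with rfl | h0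
      · simp
      · rcases Nat.lt_succ_iff_lt_or_eq.1 hi with h1 | rfl
        · rw [mem_V.1 heV i h0 h1, mem_V.1 hvN i h0 h1]
        · exact hva.symm
    rw [← h1, ← map_mul, hedef, inv_mul_cancel_right]
  · intro j
    rw [← mul_inv_mem_V, Pi.mul_apply, mul_inv_cancel_right]
    exact hv j

/-- The approximations converge coefficientwise. Since the number of commutators stays four, the
limit is still a finite product of commutators and so lies in the abstract commutator subgroup. -/
theorem V_le_commutator {d : ℕ} (hd : 1 ≤ d) : V ℤ (10 * d + 20) ≤ ⁅V ℤ d, V ℤ d⁆ := by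
  intro h hh
  let S : ℕ → Type := fun s => {u : Fin 4 → Jennings ℤ // (∀ i, u i ∈ V ℤ (2 * d + 4)) ∧
    ∀ i < 10 * d + 20 + s, co h i = co (commWord (gens d) u) i}
  have step : ∀ s (u : S s), ∃ u' : S (s + 1), ∀ j, ∀ i < s + (8 * d + 16), co (u'.1 j) i = co (u.1 j) i := by
    intro s u
    obtain ⟨u', h1, h2, h3⟩ := exists_commWord_step hd (by omega) u.2.1 u.2.2
    exact ⟨⟨u', h1, h2⟩, fun j i hi => h3 j i (by omega)⟩
  choose next hnext using step
  have h0 : commWord (gens d) 1 = 1 := by simp [commWord]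
  let u0 : S 0 := ⟨1, fun i => one_mem _, fun i hi => by
    rw [h0]
    exact mul_inv_mem_V.1 (show h * 1⁻¹ ∈ V ℤ (10 * d + 20) by rwa [inv_one, mul_one]) i hi⟩
  let U : ∀ s, S s := fun s => Nat.rec u0 next s
  have hU : ∀ s, U (s + 1) = next s (U s) := fun s => rfl
  have hlim : ∀ j, ∃ x : Jennings ℤ, ∀ s, ∀ i < s + (8 * d + 16), co x i = co ((U s).1 j) i := by
    intro j
    refine exists_limit (w := fun s => (U s).1 j) (by omega) fun s i hi => ?_
    rw [hU]
    exact hnext s (U s) j i hi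
  choose x hx using hlim
  have hxu : h = commWord (gens d) x := by
    refine ext_co fun n => ?_
    have h1 : QuotientGroup.mk' (V ℤ (n + (8 * d + 16))) (commWord (gens d) x) =
        QuotientGroup.mk' (V ℤ (n + (8 * d + 16))) (commWord (gens d) (U n).1) := by
      rw [map_commWord, map_commWord]
      congr 1
      funext j
      exact mk_eq_mk.2 (hx j n)
    rw [mk_eq_mk.1 h1 n (by omega)]
    exact (U n).2.2 n (by omega)
  have hxV : ∀ j, x j ∈ V ℤ d := by
    intro j
    refine mem_V.2 fun i h1 h2 => ?_
    rw [hx j 0 i (by omega)]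
    exact mem_V.1 ((U 0).2.1 j) i h1 (by omega)
  rw [hxu]
  have hm := fun j => Subgroup.commutator_mem_commutator (gens_mem d j) (hxV j)
  exact mul_mem (mul_mem (mul_mem (hm 0) (hm 1)) (hm 2)) (hm 3)

/-! ### Reduction modulo 2 and the chain rule. -/

section Reduction

variable {R S : Type*} [CommRing R] [CommRing S]

/-- Change of coefficients. -/
noncomputable def map (φ : R →+* S) (f : Jennings R) : Jennings S :=
  ⟨PowerSeries.map φ f.1, by rw [coeff_map, f.2.1, map_zero], by rw [coeff_map, f.2.2, map_one]⟩

theorem co_map (φ : R →+* S) (f : Jennings R) (n : ℕ) : co (map φ f) n = φ (co f n) :=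
  coeff_map φ (n + 1) f.1

theorem map_mul' (φ : R →+* S) (f g : Jennings R) : map φ (f * g) = map φ f * map φ g :=
  Subtype.ext (PowerSeries.map_subst g.hasSubst f.1)

/-- Change of coefficients as a homomorphism of groups. -/
noncomputable def mapHom (φ : R →+* S) : Jennings R →* Jennings S := MonoidHom.mk' (map φ) (map_mul' φ)

theorem map_commutator (φ : R →+* S) (f g : Jennings R) : map φ ⁅f, g⁆ = ⁅map φ f, map φ g⁆ :=
  map_commutatorElement (mapHom φ) f g

theorem map_mem {φ : R →+* S} {f : Jennings R} {n : ℕ} (hf : f ∈ V R n) : map φ f ∈ V S n :=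
  mem_V.2 fun i h1 h2 => by rw [co_map, mem_V.1 hf i h1 h2, map_zero]

end Reduction

section ModTwo

/-- The series of the coefficients of even depth; modulo 2 this is the derivative, as a series in
`x ^ 2`. -/
noncomputable def ev {R : Type*} [CommRing R] (f : Jennings R) : PowerSeries R :=
  PowerSeries.mk fun i => co f (2 * i)

theorem coeff_ev {R : Type*} [CommRing R] (f : Jennings R) (i : ℕ) : coeff i (ev f) = co f (2 * i) :=
  coeff_mk _ _

theorem expand_two_eq_sq (p : PowerSeries (ZMod 2)) : expand 2 two_ne_zero p = p ^ 2 := by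
  have h := MvPowerSeries.map_frobenius_expand (σ := Unit) (R := ZMod 2) 2 two_ne_zero (f := p)
  rw [ZMod.frobenius_zmod] at h
  have h2 : MvPowerSeries.map (RingHom.id (ZMod 2)) (MvPowerSeries.expand 2 two_ne_zero p) =
      MvPowerSeries.expand 2 two_ne_zero p := by
    rw [MvPowerSeries.map_id, RingHom.id_apply]
  rw [h2] at h
  exact h

theorem coeff_odd_add (A B : PowerSeries (ZMod 2)) (i : ℕ) :
    coeff (2 * i + 1) (X * expand 2 two_ne_zero A + expand 2 two_ne_zero B) = coeff i A := by
  rw [map_add, coeff_succ_X_mul, coeff_expand_mul, coeff_expand_of_not_dvd _ _ _ (by omega), add_zero]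

theorem eq_odd_add (f : Jennings (ZMod 2)) :
    ∃ B, f.1 = X * expand 2 two_ne_zero (ev f) + expand 2 two_ne_zero B := by
  refine ⟨PowerSeries.mk fun i => coeff (2 * i) f.1, ?_⟩
  ext n
  obtain ⟨i, rfl | rfl⟩ := Nat.even_or_odd' n
  · rw [map_add, coeff_expand_mul, coeff_mk]
    rcases i with _ | i
    · simp
    · rw [show 2 * (i + 1) = (2 * i + 1) + 1 by ring, coeff_succ_X_mul,
        coeff_expand_of_not_dvd _ _ _ (by omega), zero_add]
  · rw [coeff_odd_add, coeff_ev]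
    rfl

theorem subst_expand_two (p : PowerSeries (ZMod 2)) (g : Jennings (ZMod 2)) :
    (expand 2 two_ne_zero p).subst g.1 = expand 2 two_ne_zero (p.subst g.1) := by
  rw [expand_two_eq_sq, expand_two_eq_sq, subst_pow g.hasSubst]

/-- The chain rule `(f ∘ g)' = f'(g) g'`: modulo 2, `f'` is `ev f` at `x ^ 2`, and `g(x) ^ 2 = g(x ^
2)`. -/
theorem ev_mul (f g : Jennings (ZMod 2)) : ev (f * g) = (ev f).subst g.1 * ev g := by
  obtain ⟨A, hA⟩ := eq_odd_add f
  obtain ⟨B, hB⟩ := eq_odd_add g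
  have h : (f * g).1 = X * expand 2 two_ne_zero ((ev f).subst g.1 * ev g) +
      expand 2 two_ne_zero (B * (ev f).subst g.1 + A.subst g.1) := by
    rw [coe_mul, hA, subst_add g.hasSubst, subst_mul g.hasSubst, subst_X g.hasSubst, subst_expand_two,
      subst_expand_two, map_add, _root_.map_mul, _root_.map_mul]
    linear_combination expand 2 two_ne_zero ((ev f).subst g.1) * hB
  ext i
  rw [coeff_ev, co, h, coeff_odd_add]

theorem X_pow_dvd_ev_sub_one {f : Jennings (ZMod 2)} {a j : ℕ} (hf : f ∈ V (ZMod 2) a)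
    (hj : 2 * j < a + 2) : X ^ j ∣ ev f - 1 := by
  rw [X_pow_dvd_iff]
  intro i hi
  rw [map_sub, coeff_ev, coeff_one]
  rcases Nat.eq_zero_or_pos i with rfl | h
  · simp
  · rw [mem_V.1 hf _ (by omega) (by omega), if_neg (by omega), sub_zero]

/-- The effect of a substitution on `ev f`. -/
noncomputable def dev (f g : Jennings (ZMod 2)) : PowerSeries (ZMod 2) := (ev f).subst g.1 - ev f

theorem dev_eq (f g : Jennings (ZMod 2)) : dev f g = (ev f - 1).subst g.1 - (ev f - 1) := by
  have h : (1 : PowerSeries (ZMod 2)).subst g.1 = 1 := by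
    rw [← coe_substAlgHom g.hasSubst, _root_.map_one]
  rw [dev, subst_sub g.hasSubst, h]
  ring

theorem coeff_dev_of_lt {f g : Jennings (ZMod 2)} {d j n : ℕ} (hf : f ∈ V (ZMod 2) d)
    (hg : g ∈ V (ZMod 2) d) (hj : 2 * j < d + 2) (hn : n < j + d) : coeff n (dev f g) = 0 := by
  rw [dev_eq, map_sub, coeff_subst_of_lt (X_pow_dvd_ev_sub_one hf hj) hg hn, sub_self]

theorem coeff_dev {f g : Jennings (ZMod 2)} {d j r : ℕ} (hf : f ∈ V (ZMod 2) d)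
    (hg : g ∈ V (ZMod 2) d) (hj : 2 * j < d + 2) (hj0 : 1 ≤ j) (hd : 1 ≤ d)
    (hr : r < d ∨ (j = 1 ∧ r < d + 1)) :
    coeff (j + d + r) (dev f g) =
      ∑ i ∈ Finset.range (r + 1), ((j + i : ℕ) : ZMod 2) * (co f (2 * (j + i)) * co g (d + (r - i))) := by
  rw [dev_eq, map_sub, coeff_subst_of_dvd (X_pow_dvd_ev_sub_one hf hj) hg hd (by omega),
    add_sub_cancel_left]
  refine Finset.sum_congr rfl fun i hi => ?_
  have hi' := Finset.mem_range.1 hi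
  -- The square of `tl g` is too deep to contribute, except for `j = 1`, `r = d`, `i = 0`, where the
  -- binomial coefficient is `choose 1 2 = 0`.
  have h0 : ((j + i).choose 2 : ZMod 2) * coeff (d + (r - i)) (tl g ^ 2) = 0 := by
    by_cases h : r - i < d
    · rw [coeff_tl_sq_of_lt hg (by omega), mul_zero]
    · have h1 : j + i = 1 := by omega
      rw [h1]
      simp
  rw [h0, add_zero, map_sub, coeff_one, if_neg (by omega), sub_zero, coeff_ev]
  ring

theorem ev_commutator_mul (f g : Jennings (ZMod 2)) :
    (ev ⁅f, g⁆).subst (g * f).1 * ((ev g).subst f.1 * ev f) = (ev f).subst g.1 * ev g := by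
  rw [← ev_mul, ← ev_mul, ← ev_mul, commutatorElement_def, mul_assoc (f * g), ← mul_inv_rev,
    inv_mul_cancel_right]

/-- `ev_commutator_mul` turns into `R * (1 + S) = D * (1 + Q) - E * (1 + P)`, with `D`, `E` the two
`dev` series. To first order `R = D - E`; the products first contribute at `e + j`, where only the
leading coefficients enter. -/
theorem coeff_ev_commutator_subst {f g : Jennings (ZMod 2)} {j e : ℕ} (hj : 1 ≤ j) (hje : j < e)
    (hf : X ^ j ∣ ev f - 1) (hg : X ^ j ∣ ev g - 1) (hef : X ^ e ∣ dev f g) (heg : X ^ e ∣ dev g f) :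
    (∀ n < e + j, coeff n ((ev ⁅f, g⁆ - 1).subst (g * f).1) = coeff n (dev f g) - coeff n (dev g f)) ∧
    coeff (e + j) ((ev ⁅f, g⁆ - 1).subst (g * f).1) = coeff (e + j) (dev f g) - coeff (e + j) (dev g f)
      - coeff e (dev f g) * coeff j (ev f) + coeff e (dev g f) * coeff j (ev g) := by
  set R : PowerSeries (ZMod 2) := (ev ⁅f, g⁆ - 1).subst (g * f).1 with hR
  set P := ev f - 1 with hP
  set Q := ev g - 1 with hQ
  set S := (1 + Q + dev g f) * (1 + P) - 1 with hS
  have h1 : (1 : PowerSeries (ZMod 2)).subst (g * f).1 = 1 := by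
    rw [← coe_substAlgHom (g * f).hasSubst, _root_.map_one]
  have hRe : (ev ⁅f, g⁆).subst (g * f).1 = 1 + R := by
    rw [hR, subst_sub (g * f).hasSubst, h1]; ring
  have key : R * (1 + S) = dev f g * (1 + Q) - dev g f * (1 + P) := by
    have := ev_commutator_mul f g
    rw [hRe] at this
    have e1 : (ev g).subst f.1 = 1 + Q + dev g f := by rw [dev, hQ]; ring
    have e2 : (ev f).subst g.1 = 1 + P + dev f g := by rw [dev, hP]; ring
    have e3 : ev f = 1 + P := by rw [hP]; ring
    have e4 : ev g = 1 + Q := by rw [hQ]; ring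
    rw [e1, e2, e3, e4] at this
    rw [hS]
    linear_combination this
  have hjdev : X ^ j ∣ dev g f := by
    rw [dev_eq]
    refine dvd_sub ?_ hg
    obtain ⟨q, hq⟩ := hg
    rw [← hQ, hq, subst_mul f.hasSubst, subst_pow f.hasSubst, subst_X f.hasSubst]
    exact Dvd.dvd.mul_right (pow_dvd_pow_of_dvd f.X_dvd j) _
  have hSe : S = P + Q + (P * Q + dev g f * (1 + P)) := by rw [hS]; ring
  have hSj : X ^ j ∣ S := by
    rw [hSe]
    exact dvd_add (dvd_add hf hg) (dvd_add (Dvd.dvd.mul_right hf _) (Dvd.dvd.mul_right hjdev _))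
  have hunit : IsUnit (1 + S) := by
    rw [isUnit_iff_constantCoeff, map_add, map_one]
    have : constantCoeff S = 0 := by
      rw [← coeff_zero_eq_constantCoeff_apply]
      exact X_pow_dvd_iff.1 hSj 0 hj
    rw [this, add_zero]
    exact isUnit_one
  have hRdvd : X ^ e ∣ R := by
    rw [← hunit.dvd_mul_right, key]
    exact dvd_sub (Dvd.dvd.mul_right hef _) (Dvd.dvd.mul_right heg _)
  have hRe2 : R = dev f g - dev g f + (dev f g * Q - dev g f * P - R * S) := by
    linear_combination key
  have hlow : ∀ n < e + j, coeff n R = coeff n (dev f g) - coeff n (dev g f) := by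
    intro n hn
    rw [hRe2, map_add, map_sub, map_sub, map_sub, coeff_mul_eq_zero_of_dvd hef hg hn,
      coeff_mul_eq_zero_of_dvd heg hf hn, coeff_mul_eq_zero_of_dvd hRdvd hSj hn]
    ring
  refine ⟨hlow, ?_⟩
  have hc : ∀ {A B : PowerSeries (ZMod 2)}, X ^ e ∣ A → X ^ j ∣ B →
      coeff (e + j) (A * B) = coeff e A * coeff j B := by
    intro A B hA hB
    have := coeff_mul_of_dvd hA hB 0
    simpa using this
  have hsj : coeff j S = coeff j P + coeff j Q := by
    rw [hSe, map_add, map_add, map_add, coeff_mul_eq_zero_of_dvd hf hg (by omega),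
      coeff_mul_eq_zero_of_dvd (b := 0) heg (one_dvd _) (by omega), add_zero, add_zero]
  have hPj : coeff j (ev f) = coeff j P := by
    rw [hP, map_sub, coeff_one, if_neg (by omega), sub_zero]
  have hQj : coeff j (ev g) = coeff j Q := by
    rw [hQ, map_sub, coeff_one, if_neg (by omega), sub_zero]
  rw [hPj, hQj]
  conv_lhs => rw [hRe2]
  rw [map_add, map_sub, map_sub, map_sub, hc hef hg, hc heg hf, hc hRdvd hSj, hsj, hlow e (by omega)]
  ring

end ModTwo

/-- The cross term at depth `2 * d` is `(d + 1)` times the product of the leading coefficients,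
hence symmetric in `f` and `g`. -/
theorem commutator_mem_succ {R : Type*} [CommRing R] {f g : Jennings R} {d : ℕ} (hd : 1 ≤ d)
    (hf : f ∈ V R d) (hg : g ∈ V R d) : ⁅f, g⁆ ∈ V R (2 * d + 1) := by
  refine mem_V_succ (by rw [two_mul]; exact commutator_mem hf hg) ?_
  have h1 := co_mul_of_lt_depth (r := 0) hf hg hd (by omega)
  have h2 := co_mul_of_lt_depth (r := 0) hg hf hd (by omega)
  simp only [add_zero, zero_add, Finset.sum_range_one, Nat.sub_self, ← two_mul] at h1 h2
  rw [co_commutator hf hg (mul_mem hg hf) (by omega) (by omega), h1, h2]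
  ring

theorem co_commutator_of_lt {R : Type*} [CommRing R] {f g : Jennings R} {d n : ℕ} (hd : 1 ≤ d)
    (hf : f ∈ V R d) (hg : g ∈ V R d) (hn : 1 ≤ n) (h : n < 3 * d + 1) :
    co ⁅f, g⁆ n = co (f * g) n - co (g * f) n := by
  have h1 := co_mul_of_lt (commutator_mem_succ hd hf hg) (mul_mem hg hf) hn (by omega)
  rw [commutatorElement_def, mul_assoc (f * g), ← mul_inv_rev, inv_mul_cancel_right] at h1
  rw [h1, commutatorElement_def, mul_assoc (f * g), ← mul_inv_rev]
  ring

section ModTwo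

variable {f g : Jennings (ZMod 2)} {d : ℕ}

theorem coeff_subst_ev_commutator (hd : 1 ≤ d) (hf : f ∈ V (ZMod 2) d) (hg : g ∈ V (ZMod 2) d)
    {n : ℕ} (hn : 1 ≤ n) (h : n < 2 * d + 1 ∨ (d % 2 = 1 ∧ n = 2 * d + 1)) :
    coeff n ((ev ⁅f, g⁆ - 1).subst (g * f).1) = co ⁅f, g⁆ (2 * n) := by
  have hc := X_pow_dvd_ev_sub_one (commutator_mem_succ hd hf hg) (j := d + 1) (by omega)
  have e : coeff n (ev ⁅f, g⁆ - 1) = co ⁅f, g⁆ (2 * n) := by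
    rw [map_sub, coeff_one, if_neg (by omega), sub_zero, coeff_ev]
  rw [← e]
  rcases h with h | ⟨h, rfl⟩
  · exact coeff_subst_of_lt hc (mul_mem hg hf) (by omega)
  -- At the boundary depth the correction carries the factor `d + 1`, which is even.
  · have := coeff_subst_of_dvd hc (mul_mem hg hf) hd (r := 0) (by omega)
    rw [show d + 1 + d + 0 = 2 * d + 1 by ring] at this
    rw [this, Finset.sum_range_one, coeff_tl_sq_of_lt (mul_mem hg hf) (by omega)]
    have h2 : ((d + 1 + 0 : ℕ) : ZMod 2) = 0 := by
      rw [ZMod.natCast_eq_zero_iff]; omega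
    rw [h2]
    ring

theorem co_commutator_two_mul {j e n : ℕ} (hd : 1 ≤ d) (hf : f ∈ V (ZMod 2) d) (hg : g ∈ V (ZMod 2) d)
    (hj : 1 ≤ j) (hjd : 2 * j < d + 2) (hje : j < e)
    (hef : ∀ n < e, coeff n (dev f g) = 0) (heg : ∀ n < e, coeff n (dev g f) = 0)
    (hn : 1 ≤ n) (h : n < 2 * d + 1 ∨ (d % 2 = 1 ∧ n = 2 * d + 1)) (hne : n < e + j) :
    co ⁅f, g⁆ (2 * n) = coeff n (dev f g) - coeff n (dev g f) := by
  rw [← coeff_subst_ev_commutator hd hf hg hn h]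
  exact (coeff_ev_commutator_subst hj hje (X_pow_dvd_ev_sub_one hf hjd) (X_pow_dvd_ev_sub_one hg hjd)
    (X_pow_dvd_iff.2 hef) (X_pow_dvd_iff.2 heg)).1 n hne

theorem two_zmod : (2 : ZMod 2) = 0 := rfl

theorem natCast_of_even {n : ℕ} (h : n % 2 = 0) : (n : ZMod 2) = 0 := by
  rw [ZMod.natCast_eq_zero_iff]; omega

theorem natCast_of_odd {n : ℕ} (h : n % 2 = 1) : (n : ZMod 2) = 1 := by
  rw [← ZMod.natCast_mod, h, Nat.cast_one]

theorem mul_self_zmod_two (a : ZMod 2) : a * a = a := by revert a; decide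

theorem co_commutator_two_mul_of_lt (hd : 1 ≤ d) (hf : f ∈ V (ZMod 2) d) (hg : g ∈ V (ZMod 2) d)
    {n : ℕ} (hn : 1 ≤ n) (h : n < (d + 1) / 2 + d) : co ⁅f, g⁆ (2 * n) = 0 := by
  have h1 : ∀ n < (d + 1) / 2 + d, coeff n (dev f g) = 0 := fun n hn =>
    coeff_dev_of_lt hf hg (by omega) hn
  have h2 : ∀ n < (d + 1) / 2 + d, coeff n (dev g f) = 0 := fun n hn =>
    coeff_dev_of_lt hg hf (by omega) hn
  rw [co_commutator_two_mul hd hf hg (j := (d + 1) / 2) (by omega) (by omega) (by omega) h1 h2 hn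
    (by omega) (by omega), h1 n h, h2 n h, sub_zero]

/-- The first coefficient of even depth that can be nonzero on commutators. -/
theorem co_commutator_two_mul_first (hd : 1 ≤ d) (hf : f ∈ V (ZMod 2) d) (hg : g ∈ V (ZMod 2) d)
    {j : ℕ} (hj : j = (d + 1) / 2) :
    co ⁅f, g⁆ (2 * (j + d)) = (j : ZMod 2) * (co f (2 * j) * co g d - co g (2 * j) * co f d) := by
  have h1 : ∀ n < j + d, coeff n (dev f g) = 0 := fun n hn => coeff_dev_of_lt hf hg (by omega) hn
  have h2 : ∀ n < j + d, coeff n (dev g f) = 0 := fun n hn => coeff_dev_of_lt hg hf (by omega) hn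
  rw [co_commutator_two_mul hd hf hg (j := j) (by omega) (by omega) (by omega) h1 h2 (by omega)
    (by omega) (by omega)]
  have e1 := coeff_dev (r := 0) (j := j) hf hg (by omega) (by omega) hd (by omega)
  have e2 := coeff_dev (r := 0) (j := j) hg hf (by omega) (by omega) hd (by omega)
  simp only [add_zero, zero_add, Finset.sum_range_one, Nat.sub_self] at e1 e2
  rw [e1, e2]
  ring

theorem coeff_dev_second (hf : f ∈ V (ZMod 2) d) (hg : g ∈ V (ZMod 2) d) (hd : 1 ≤ d)
    {j : ℕ} (hj : j = (d + 1) / 2) :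
    coeff (j + d + 1) (dev f g) = (j : ZMod 2) * (co f (2 * j) * co g (d + 1)) +
      (j + 1 : ℕ) * (co f (2 * j + 2) * co g d) := by
  rw [coeff_dev (r := 1) (j := j) hf hg (by omega) (by omega) hd (by omega), Finset.sum_range_succ,
    Finset.sum_range_one]
  simp [mul_add]

theorem co_commutator_two_mul_second (hd : 2 ≤ d) (hf : f ∈ V (ZMod 2) d) (hg : g ∈ V (ZMod 2) d)
    {j : ℕ} (hj : j = (d + 1) / 2) :
    co ⁅f, g⁆ (2 * (j + d + 1)) = (j : ZMod 2) * (co f (2 * j) * co g (d + 1) - co g (2 * j) * co f (d + 1))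
      + (j + 1 : ℕ) * (co f (2 * j + 2) * co g d - co g (2 * j + 2) * co f d) := by
  have h1 : ∀ n < j + d, coeff n (dev f g) = 0 := fun n hn => coeff_dev_of_lt hf hg (by omega) hn
  have h2 : ∀ n < j + d, coeff n (dev g f) = 0 := fun n hn => coeff_dev_of_lt hg hf (by omega) hn
  have e1 := coeff_dev_second hf hg (by omega) hj
  have e2 := coeff_dev_second hg hf (by omega) hj
  -- For `d = 2` the depth is exactly `e + j`, so the quadratic correction appears; it cancels
  -- because `a * a = a` modulo 2.
  rcases Nat.lt_or_ge d 3 with h3 | h3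
  · obtain rfl : d = 2 := by omega
    obtain rfl : j = 1 := by omega
    rw [← coeff_subst_ev_commutator (by omega) hf hg (by omega) (by omega)]
    have := (coeff_ev_commutator_subst (j := 1) (e := 3) le_rfl (by omega)
      (X_pow_dvd_ev_sub_one hf (by omega)) (X_pow_dvd_ev_sub_one hg (by omega))
      (X_pow_dvd_iff.2 h1) (X_pow_dvd_iff.2 h2)).2
    have e3 := coeff_dev (r := 0) (j := 1) hf hg (by omega) (by omega) (by omega) (by omega)
    have e4 := coeff_dev (r := 0) (j := 1) hg hf (by omega) (by omega) (by omega) (by omega)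
    simp only [add_zero, zero_add, Finset.sum_range_one, Nat.sub_self, Nat.reduceAdd,
      Nat.reduceMul] at this e1 e2 e3 e4 ⊢
    rw [this, e1, e2, e3, e4, coeff_ev, coeff_ev]
    push_cast
    linear_combination (-co g 2) * mul_self_zmod_two (co f 2) + co f 2 * mul_self_zmod_two (co g 2)
  · rw [co_commutator_two_mul (by omega) hf hg (j := j) (by omega) (by omega) (by omega) h1 h2
      (by omega) (by omega) (by omega), e1, e2]
    ring

/-- Here the depth is exactly `e + j` with `e = 2`, `j = 1`: the first-order part cancels modulo 2
and the correction alone gives the value. -/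
theorem co_commutator_six (hf : f ∈ V (ZMod 2) 1) (hg : g ∈ V (ZMod 2) 1) :
    co ⁅f, g⁆ 6 = co f 2 * co g 1 + co g 2 * co f 1 := by
  have h1 : ∀ n < 2, coeff n (dev f g) = 0 := fun n hn =>
    coeff_dev_of_lt hf hg (j := 1) (by omega) hn
  have h2 : ∀ n < 2, coeff n (dev g f) = 0 := fun n hn =>
    coeff_dev_of_lt hg hf (j := 1) (by omega) hn
  have e1 := coeff_dev_second hf hg le_rfl (j := 1) rfl
  have e2 := coeff_dev_second hg hf le_rfl (j := 1) rfl
  have e3 := coeff_dev (r := 0) (j := 1) hf hg (by omega) (by omega) (by omega) (by omega)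
  have e4 := coeff_dev (r := 0) (j := 1) hg hf (by omega) (by omega) (by omega) (by omega)
  have := (coeff_ev_commutator_subst (j := 1) (e := 2) le_rfl (by omega)
    (X_pow_dvd_ev_sub_one hf (by omega)) (X_pow_dvd_ev_sub_one hg (by omega))
    (X_pow_dvd_iff.2 h1) (X_pow_dvd_iff.2 h2)).2
  rw [show 6 = 2 * 3 from rfl, ← coeff_subst_ev_commutator le_rfl hf hg (by omega) (by omega)]
  simp only [add_zero, zero_add, Finset.sum_range_one, Nat.sub_self, Nat.reduceAdd,
    Nat.reduceMul] at this e1 e2 e3 e4 ⊢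
  rw [this, e1, e2, e3, e4, coeff_ev, coeff_ev]
  push_cast
  linear_combination (-co g 1) * mul_self_zmod_two (co f 2) + co f 1 * mul_self_zmod_two (co g 2) +
    (co f 4 * co g 1 - co g 4 * co f 1 - co f 2 * co g 1) * two_zmod

/-- Now `j = (d + 1) / 2` is even, so `dev` starts one step later, and at `j + d + 2` only the
middle term has an odd factor `j + 1`. -/
theorem co_commutator_two_mul_third (hd : d % 4 = 3) (hf : f ∈ V (ZMod 2) d) (hg : g ∈ V (ZMod 2) d) :
    co ⁅f, g⁆ (3 * d + 5) = co f (d + 3) * co g (d + 1) + co g (d + 3) * co f (d + 1) := by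
  obtain ⟨j, hj⟩ : ∃ j, d + 1 = 2 * j := ⟨(d + 1) / 2, by omega⟩
  have hzero : ∀ {f g : Jennings (ZMod 2)}, f ∈ V (ZMod 2) d → g ∈ V (ZMod 2) d →
      ∀ n < j + d + 1, coeff n (dev f g) = 0 := by
    intro f g hf hg n hn
    rcases Nat.lt_succ_iff_lt_or_eq.1 hn with h | rfl
    · exact coeff_dev_of_lt hf hg (by omega) h
    · have e1 := coeff_dev (r := 0) (j := j) hf hg (by omega) (by omega) (by omega) (by omega)
      simp only [add_zero, zero_add, Finset.sum_range_one, Nat.sub_self] at e1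
      rw [e1, natCast_of_even (by omega), zero_mul]
  have hval : ∀ {f g : Jennings (ZMod 2)}, f ∈ V (ZMod 2) d → g ∈ V (ZMod 2) d →
      coeff (j + d + 2) (dev f g) = co f (d + 3) * co g (d + 1) := by
    intro f g hf hg
    rw [coeff_dev (r := 2) (j := j) hf hg (by omega) (by omega) (by omega) (by omega),
      Finset.sum_range_succ, Finset.sum_range_succ, Finset.sum_range_one, natCast_of_even (by omega),
      natCast_of_odd (by omega), natCast_of_even (by omega), show 2 * (j + 1) = d + 3 by omega]
    ring
  rw [show 3 * d + 5 = 2 * (j + d + 2) by omega, co_commutator_two_mul (by omega) hf hg (j := j)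
    (e := j + d + 1) (by omega) (by omega) (by omega) (hzero hf hg) (hzero hg hf) (by omega) (by omega)
    (by omega), hval hf hg, hval hg hf]
  linear_combination (-(co g (d + 3) * co f (d + 1))) * two_zmod

end ModTwo
-- Criteria for the torsion part.
theorem nonempty_equiv_of_leads {d : ℕ} (hd : 1 ≤ d) {T : Type*} [AddCommGroup T]
    (χ : Jennings ℤ → T)
    (hadd : ∀ f ∈ V ℤ (2 * d + 1), ∀ g ∈ V ℤ (2 * d + 1), χ (f * g) = χ f + χ g)
    (hsurj : ∀ t, ∃ f ∈ V ℤ (2 * d + 1), χ f = t)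
    (hcomm : ∀ f ∈ V ℤ d, ∀ g ∈ V ℤ d, χ ⁅f, g⁆ = 0)
    (hlead : ∀ N (hN : 2 * d + 1 ≤ N), ∀ f ∈ V ℤ N, χ f = 0 → co f N ∈ leads d N (by omega)) :
    Nonempty (Additive (Abelianization (level ℤ (d + 1))) ≃+ (Fin (d + 1) → ℤ) × T) := by
  have h1 : χ 1 = 0 := by
    have := hadd 1 (one_mem _) 1 (one_mem _)
    rw [mul_one] at this
    exact left_eq_add.1 this
  let K : Subgroup (Jennings ℤ) :=
    { carrier := {f | f ∈ V ℤ (2 * d + 1) ∧ χ f = 0}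
      one_mem' := ⟨one_mem _, h1⟩
      mul_mem' := fun {f g} hf hg => ⟨mul_mem hf.1 hg.1, by rw [hadd f hf.1 g hg.1, hf.2, hg.2, add_zero]⟩
      inv_mem' := fun {f} hf => ⟨inv_mem hf.1, by
        have := hadd f hf.1 f⁻¹ (inv_mem hf.1)
        rw [mul_inv_cancel, h1, hf.2, zero_add] at this
        exact this.symm⟩ }
  have hK : ⁅V ℤ d, V ℤ d⁆ ≤ K := Subgroup.commutator_le.2 fun f hf g hg =>
    ⟨commutator_mem_succ hd hf hg, hcomm f hf g hg⟩
  refine nonempty_equiv_of_invariant hd χ hadd hsurj fun f hf => ⟨fun hf0 => ?_, fun h => (hK h).2⟩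
  -- Commutator-subgroup elements strip off one leading coefficient after another, and `χ` stays
  -- zero; finitely many rounds reach `V ℤ (10 * d + 20)`.
  have key : ∀ s, ∃ h ∈ V ℤ (2 * d + 1 + s), ∃ z ∈ ⁅V ℤ d, V ℤ d⁆, χ h = 0 ∧ f = h * z := by
    intro s
    induction s with
    | zero => exact ⟨f, hf, 1, one_mem _, hf0, (mul_one f).symm⟩
    | succ s ih =>
      obtain ⟨h, hh, z, hz, hh0, rfl⟩ := ih
      obtain ⟨w, hw, hwV, hwa⟩ := hlead (2 * d + 1 + s) (by omega) h hh hh0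
      have hV : h * w⁻¹ ∈ V ℤ (2 * d + 1 + (s + 1)) := by
        rw [mul_inv_mem_V]
        intro i hi
        rcases Nat.eq_zero_or_pos i with rfl | h0
        · simp
        · rcases Nat.lt_succ_iff_lt_or_eq.1 (show i < (2 * d + 1 + s) + 1 by omega) with h2 | rfl
          · rw [mem_V.1 hh i h0 h2, mem_V.1 hwV i h0 h2]
          · exact hwa.symm
      refine ⟨h * w⁻¹, hV, w * z, mul_mem hw hz, ?_, by group⟩
      have := hadd (h * w⁻¹) (V_anti (by omega) hV) w (hK hw).1
      rw [inv_mul_cancel_right, hh0, (hK hw).2, add_zero] at this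
      exact this.symm
  obtain ⟨h, hh, z, hz, -, rfl⟩ := key (10 * d + 20)
  exact mul_mem (V_le_commutator hd (V_anti (by omega) hh)) hz

/-- At the end depth `4 * d + 2` the cross term has the even factor `2 * d + 2`. This depth is
needed for `d = 1` and `d = 3`. -/
theorem exists_co_mul_eq {d n : ℕ} {f g : Jennings ℤ} (hf : f ∈ V ℤ (2 * d + 1))
    (hg : g ∈ V ℤ (2 * d + 1)) (hn : 1 ≤ n) (hn' : n ≤ 4 * d + 2) :
    ∃ z, co (f * g) n = co f n + co g n + 2 * z := by
  rcases Nat.lt_or_eq_of_le hn' with h | rfl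
  · exact ⟨0, by rw [co_mul_of_mem hf hg hn (by omega)]; ring⟩
  · have := co_mul_of_lt_depth (r := 0) hf hg (by omega) (by omega)
    simp only [add_zero, zero_add, Finset.sum_range_one, Nat.sub_self] at this
    rw [show 2 * d + 1 + (2 * d + 1) = 4 * d + 2 by ring] at this
    refine ⟨(d + 1) * (co f (2 * d + 1) * co g (2 * d + 1)), ?_⟩
    rw [this]
    push_cast
    ring

/-- A series whose coefficients of the given depths reduce to the given residues. -/
theorem exists_ofCo {r : ℕ} {deg : Fin r → ℕ} (hinj : Function.Injective deg) (y : Fin r → ZMod 2) :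
    ∃ c : ℕ → ℤ, (∀ i, (c (deg i) : ZMod 2) = y i) ∧ ∀ n, (∀ i, deg i ≠ n) → c n = 0 := by
  classical
  refine ⟨fun n => if h : ∃ i, deg i = n then ((y h.choose).val : ℤ) else 0, fun i => ?_, fun n hn => ?_⟩
  · have h : ∃ k, deg k = deg i := ⟨i, rfl⟩
    have hk := hinj h.choose_spec
    simp only [dif_pos h, hk]
    simp
  · simp only [dif_neg (not_exists.2 hn)]

theorem intCast_eq_zero_iff_even (x : ℤ) : (x : ZMod 2) = 0 ↔ Even x := by
  rw [even_iff_two_dvd]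
  exact ZMod.intCast_zmod_eq_zero_iff_dvd x 2

/-- The depths `deg i` are those where only even leading coefficients are available; the multiple `ε
i` of the coefficient of depth `2 * d + 1` makes the invariant vanish on commutators. -/
theorem nonempty_equiv_zmod_two {d r : ℕ} (hd : 1 ≤ d) (deg : Fin r → ℕ) (ε : Fin r → ℤ)
    (hinj : Function.Injective deg)
    (hdeg : ∀ i, Even (deg i) ∧ 2 * d + 2 ≤ deg i ∧ deg i ≤ 4 * d + 2)
    (hcomm : ∀ f ∈ V ℤ d, ∀ g ∈ V ℤ d, ∀ i,
      Even (co ⁅f, g⁆ (deg i) + ε i * co ⁅f, g⁆ (2 * d + 1)))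
    (hlead : ∀ N (hN : 2 * d + 2 ≤ N), Even N → (∀ i, deg i ≠ N) → ∀ a, a ∈ leads d N (by omega)) :
    Nonempty (Additive (Abelianization (level ℤ (d + 1))) ≃+ (Fin (d + 1) → ℤ) × (Fin r → ZMod 2)) := by
  refine nonempty_equiv_of_leads hd
    (fun f i => ((co f (deg i) + ε i * co f (2 * d + 1) : ℤ) : ZMod 2)) ?_ ?_ ?_ ?_
  · intro f hf g hg
    funext i
    obtain ⟨z, hz⟩ := exists_co_mul_eq hf hg (n := deg i) (by have := hdeg i; omega) (hdeg i).2.2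
    rw [Pi.add_apply, hz, co_mul_of_mem hf hg (by omega) (by omega)]
    push_cast
    linear_combination (z : ZMod 2) * two_zmod
  · intro y
    obtain ⟨c, hc, hc0⟩ := exists_ofCo hinj y
    refine ⟨ofCo c, mem_V.2 fun n h1 h2 => ?_, ?_⟩
    · rw [co_ofCo c h1, hc0 n fun i hi => by have := hdeg i; omega]
    · funext i
      have h1 : c (2 * d + 1) = 0 := hc0 _ fun i hi => by have := hdeg i; omega
      rw [co_ofCo c (by have := hdeg i; omega), co_ofCo c (by omega), h1, ← hc i, mul_zero, add_zero]
  · intro f hf g hg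
    funext i
    exact (intCast_eq_zero_iff_even _).2 (hcomm f hf g hg i)
  · intro N hN f hf hχ
    rcases Nat.even_or_odd N with he | ho
    · have hN2 : 2 * d + 2 ≤ N := by
        rw [Nat.even_iff] at he; omega
      by_cases h : ∃ i, deg i = N
      · obtain ⟨i, rfl⟩ := h
        have := (intCast_eq_zero_iff_even _).1 (congrFun hχ i)
        rw [mem_V.1 hf (2 * d + 1) (by omega) (by omega), mul_zero, add_zero] at this
        exact leads_of_even hd hN2 he this
      · exact hlead N hN2 he (not_exists.1 h) _
    · exact leads_of_odd hd hN ho _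

theorem four_zmod : (4 : ZMod 4) = 0 := rfl

/-- The obstructions at depths `n₁` and `n₂` merge into one cyclic group of order 4: the coefficient
at `n₁` counts once and that at `n₂` twice, so a zero of the invariant led by either depth has an
even leading coefficient. -/
theorem nonempty_equiv_zmod_four {d r : ℕ} (hd : 2 ≤ d) (deg : Fin r → ℕ) {n₁ n₂ : ℕ} (ε : ℤ)
    (hinj : Function.Injective deg)
    (hdeg : ∀ i, Even (deg i) ∧ 2 * d + 2 ≤ deg i ∧ deg i ≤ 4 * d + 2)
    (hdeg₁ : ∀ i, deg i ≠ n₁) (h₁ : 2 * d + 2 ≤ n₁) (hn : n₁ < n₂) (h₂ : n₂ ≤ 4 * d + 2) (he₁ : Even n₁)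
    (he₂ : Even n₂) (hdeg₂ : ∀ i, deg i ≠ n₂)
    (hcomm : ∀ f ∈ V ℤ d, ∀ g ∈ V ℤ d, ∀ i, Even (co ⁅f, g⁆ (deg i)))
    (hcomm₄ : ∀ f ∈ V ℤ d, ∀ g ∈ V ℤ d, (4 : ℤ) ∣ co ⁅f, g⁆ n₁ + 2 * co ⁅f, g⁆ n₂ +
      2 * ε * co ⁅f, g⁆ (2 * d + 1))
    (hlead : ∀ N (hN : 2 * d + 2 ≤ N), Even N → (∀ i, deg i ≠ N) → N ≠ n₁ → N ≠ n₂ →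
      ∀ a, a ∈ leads d N (by omega)) :
    Nonempty (Additive (Abelianization (level ℤ (d + 1))) ≃+
      (Fin (d + 1) → ℤ) × ZMod 4 × (Fin r → ZMod 2)) := by
  refine nonempty_equiv_of_leads (by omega)
    (fun f => (((co f n₁ + 2 * co f n₂ + 2 * ε * co f (2 * d + 1) : ℤ) : ZMod 4),
      fun i => ((co f (deg i) : ℤ) : ZMod 2))) ?_ ?_ ?_ ?_
  · intro f hf g hg
    refine Prod.ext ?_ ?_
    · obtain ⟨z, hz⟩ := exists_co_mul_eq hf hg (n := n₂) (by omega) h₂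
      rw [Prod.fst_add]
      dsimp only
      rw [hz, co_mul_of_mem hf hg (by omega) (by omega), co_mul_of_mem hf hg (by omega) (by omega)]
      push_cast
      linear_combination (z : ZMod 4) * four_zmod
    · funext i
      obtain ⟨z, hz⟩ := exists_co_mul_eq hf hg (n := deg i) (by have := hdeg i; omega) (hdeg i).2.2
      rw [Prod.snd_add, Pi.add_apply]
      dsimp only
      rw [hz]
      push_cast
      linear_combination (z : ZMod 2) * two_zmod
  · rintro ⟨x, y⟩
    obtain ⟨c, hc, hc0⟩ := exists_ofCo hinj y
    set c' : ℕ → ℤ := fun n => if n = n₁ then (x.val : ℤ) else c n with hc'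
    refine ⟨ofCo c', mem_V.2 fun n h1 h2 => ?_, Prod.ext ?_ ?_⟩
    · rw [co_ofCo c' h1, hc']
      dsimp only
      rw [if_neg (by omega), hc0 n fun i hi => by have := hdeg i; omega]
    · have e1 : c (2 * d + 1) = 0 := hc0 _ fun i hi => by have := hdeg i; omega
      dsimp only
      rw [co_ofCo c' (by omega), co_ofCo c' (by omega), co_ofCo c' (by omega), hc']
      dsimp only
      rw [if_pos rfl, if_neg (by omega), if_neg (by omega), e1, hc0 n₂ hdeg₂]
      simp
    · funext i
      dsimp only
      rw [co_ofCo c' (by have := hdeg i; omega), hc']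
      dsimp only
      rw [if_neg (hdeg₁ i), hc i]
  · intro f hf g hg
    refine Prod.ext ?_ ?_
    · exact (ZMod.intCast_zmod_eq_zero_iff_dvd _ 4).2 (hcomm₄ f hf g hg)
    · funext i
      exact (intCast_eq_zero_iff_even _).2 (hcomm f hf g hg i)
  · intro N hN f hf hχ
    rcases Nat.even_or_odd N with he | ho
    · have hN2 : 2 * d + 2 ≤ N := by
        rw [Nat.even_iff] at he; omega
      have h4 := (ZMod.intCast_zmod_eq_zero_iff_dvd _ 4).1 (congrArg Prod.fst hχ)
      rw [mem_V.1 hf (2 * d + 1) (by omega) (by omega), mul_zero, add_zero] at h4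
      obtain ⟨q, hq⟩ := h4
      push_cast at hq
      by_cases h : ∃ i, deg i = N
      · obtain ⟨i, rfl⟩ := h
        exact leads_of_even (by omega) hN2 he
          ((intCast_eq_zero_iff_even _).1 (congrFun (congrArg Prod.snd hχ) i))
      by_cases h1 : N = n₁
      · subst h1
        exact leads_of_even (by omega) hN2 he ⟨2 * q - co f n₂, by linear_combination hq⟩
      by_cases h2 : N = n₂
      · subst h2
        rw [mem_V.1 hf n₁ (by omega) hn] at hq
        exact leads_of_even (by omega) hN2 he ⟨q, by linarith⟩
      · exact hlead N hN2 he (not_exists.1 h) h1 h2 _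
    · exact leads_of_odd (by omega) hN ho _

/-- One of `N - 2 * d` and `N - 2 * d - 2` is `2` modulo 4, so `m = d` or `m = d + 1` serves. The
second choice fails only for `N` at most `3 * d + 5`: `3 * d + 4` is treated apart and the other two
are genuine exceptions. -/
theorem leads_of_even_of_le {d N : ℕ} (hd : 1 ≤ d) (hN : 3 * d + 3 ≤ N) (he : N % 2 = 0)
    (h1 : d % 4 = 1 → N ≠ 3 * d + 3) (h3 : d % 4 = 3 → N ≠ 3 * d + 5) (a : ℤ) :
    a ∈ leads d N (by omega) := by
  by_cases h : (N - 2 * d) % 4 = 2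
  · have := leads_of_mod_four (d := d) (m := d) (n := N - 2 * d) hd le_rfl (by omega) h a
    simpa only [show N - 2 * d + 2 * d = N by omega] using this
  · by_cases h0 : N = 3 * d + 4
    · subst h0
      exact leads_three_mul_add_four hd (by omega) a
    · have := leads_of_mod_four (d := d) (m := d + 1) (n := N - 2 * d - 2) hd (by omega) (by omega)
        (by omega) a
      simpa only [show N - 2 * d - 2 + 2 * (d + 1) = N by omega] using this

/-! ### Parity and divisibility by 4 of the coefficients of commutators. -/

section Commutators

theorem co_commutator_two_mul_add_one {d : ℕ} (hd : 1 ≤ d) {f g : Jennings (ZMod 2)}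
    (hf : f ∈ V (ZMod 2) d) (hg : g ∈ V (ZMod 2) d) :
    co ⁅f, g⁆ (2 * d + 1) = co f d * co g (d + 1) + co g d * co f (d + 1) := by
  rw [co_commutator_of_lt hd hf hg (by omega) (by omega)]
  have h : ∀ {f g : Jennings (ZMod 2)}, f ∈ V (ZMod 2) d → g ∈ V (ZMod 2) d →
      co (f * g) (2 * d + 1) = co f (2 * d + 1) + co g (2 * d + 1) +
        ((d + 1 : ℕ) * (co f d * co g (d + 1)) + (d + 2 : ℕ) * (co f (d + 1) * co g d)) +
        if d = 1 then co f 1 * co g 1 else 0 := by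
    intro f g hf hg
    have := co_mul (r := 1) hf hg hd hd (by omega)
    rw [← two_mul, Finset.sum_range_succ, Finset.sum_range_one, coeff_tl_sq_of_lt hg
      (show d + (1 - 1) < 2 * d by omega)] at this
    rw [this]
    by_cases h1 : d = 1
    · subst h1
      have h2 := coeff_tl_sq (r := 0) le_rfl hg
      simp only [add_zero, zero_add, Finset.sum_range_one, Nat.sub_self, mul_one] at h2
      simp only [add_zero, Nat.sub_zero, Nat.reduceAdd, h2, mul_self_zmod_two]
      simp
      ring
    · rw [coeff_tl_sq_of_lt hg (by omega), if_neg h1]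
      simp only [add_zero, Nat.sub_zero, Nat.sub_self]
      push_cast
      ring
  rw [h hf hg, h hg hf]
  have h2 : ((d + 2 : ℕ) : ZMod 2) = (d + 1 : ℕ) + 1 := by push_cast; ring
  rw [h2]
  rcases Nat.mod_two_eq_zero_or_one (d + 1) with h3 | h3
  · rw [natCast_of_even h3]
    split_ifs <;> linear_combination (-(co g (d + 1) * co f d)) * two_zmod
  · rw [natCast_of_odd h3]
    split_ifs <;> linear_combination (-(co g d * co f (d + 1)) + co f (d + 1) * co g d - co g (d + 1) * co f d) * two_zmod

end Commutators

/-- Reduction of the coefficients modulo 2. -/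
noncomputable abbrev red (f : Jennings ℤ) : Jennings (ZMod 2) := map (Int.castRingHom (ZMod 2)) f

theorem co_red_commutator (f g : Jennings ℤ) (n : ℕ) :
    ((co ⁅f, g⁆ n : ℤ) : ZMod 2) = co ⁅red f, red g⁆ n := by
  rw [← map_commutator, co_map]
  rfl

theorem co_red (f : Jennings ℤ) (n : ℕ) : co (red f) n = ((co f n : ℤ) : ZMod 2) := co_map _ f n

variable {d : ℕ} {f g : Jennings ℤ}

theorem even_co_commutator_of_lt (hd : 1 ≤ d) (hf : f ∈ V ℤ d) (hg : g ∈ V ℤ d) {n : ℕ} (hn : 2 ≤ n)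
    (he : Even n) (h : n < 2 * ((d + 1) / 2 + d)) : Even (co ⁅f, g⁆ n) := by
  obtain ⟨m, rfl⟩ := he
  rw [← intCast_eq_zero_iff_even, co_red_commutator, ← two_mul]
  exact co_commutator_two_mul_of_lt hd (map_mem hf) (map_mem hg) (by omega) (by omega)

theorem even_add_of_eq {x y : ℤ} (h : (x : ZMod 2) = y) : Even (x + y) := by
  rw [← intCast_eq_zero_iff_even]
  push_cast
  rw [h]
  linear_combination (y : ZMod 2) * two_zmod

theorem four_dvd_of_eq {x y z : ℤ} (hx : x = 2 * y) (h : (z : ZMod 2) = y) : (4 : ℤ) ∣ x + 2 * z := by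
  obtain ⟨w, hw⟩ := even_add_of_eq h
  exact ⟨w, by linear_combination hx + 2 * hw⟩

theorem even_co_first_of_one (hd : d % 4 = 1) (hf : f ∈ V ℤ d) (hg : g ∈ V ℤ d) :
    Even (co ⁅f, g⁆ (3 * d + 1) + co ⁅f, g⁆ (2 * d + 1)) := by
  obtain ⟨j, hj⟩ : ∃ j, d + 1 = 2 * j := ⟨(d + 1) / 2, by omega⟩
  have h := co_commutator_two_mul_first (by omega) (map_mem hf) (map_mem hg) (d := d) (j := j) (by omega)
    (f := red f) (g := red g)
  rw [show 2 * (j + d) = 3 * d + 1 by omega, natCast_of_odd (by omega), ← hj] at h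
  refine even_add_of_eq ?_
  rw [co_red_commutator, co_red_commutator, h,
    co_commutator_two_mul_add_one (by omega) (map_mem hf) (map_mem hg)]
  linear_combination (-(co (red f) d * co (red g) (d + 1))) * two_zmod

theorem even_co_second_of_one (hd : d % 4 = 1) (hd1 : d ≠ 1) (hf : f ∈ V ℤ d) (hg : g ∈ V ℤ d) :
    Even (co ⁅f, g⁆ (3 * d + 3)) := by
  obtain ⟨j, hj⟩ : ∃ j, d + 1 = 2 * j := ⟨(d + 1) / 2, by omega⟩
  have h := co_commutator_two_mul_second (by omega) (map_mem hf) (map_mem hg) (d := d) (j := j) (by omega)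
    (f := red f) (g := red g)
  rw [show 2 * (j + d + 1) = 3 * d + 3 by omega, natCast_of_odd (by omega), ← hj,
    natCast_of_even (by omega)] at h
  rw [← intCast_eq_zero_iff_even, co_red_commutator, h]
  ring

theorem even_co_six (hf : f ∈ V ℤ 1) (hg : g ∈ V ℤ 1) : Even (co ⁅f, g⁆ 6 + co ⁅f, g⁆ 3) := by
  refine even_add_of_eq ?_
  rw [co_red_commutator, co_red_commutator, co_commutator_six (map_mem hf) (map_mem hg),
    co_commutator_two_mul_add_one le_rfl (map_mem hf) (map_mem hg)]
  ring

theorem even_co_first_of_even (hd : 1 ≤ d) (he : d % 2 = 0) (hf : f ∈ V ℤ d) (hg : g ∈ V ℤ d) :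
    Even (co ⁅f, g⁆ (3 * d)) := by
  obtain ⟨j, hj⟩ : ∃ j, d = 2 * j := ⟨d / 2, by omega⟩
  have h := co_commutator_two_mul_first (by omega) (map_mem hf) (map_mem hg) (d := d) (j := j) (by omega)
    (f := red f) (g := red g)
  rw [show 2 * (j + d) = 3 * d by omega, ← hj] at h
  rw [← intCast_eq_zero_iff_even, co_red_commutator, h]
  ring

theorem even_co_second_of_two (hd : d % 4 = 2) (hf : f ∈ V ℤ d) (hg : g ∈ V ℤ d) :
    Even (co ⁅f, g⁆ (3 * d + 2) + co ⁅f, g⁆ (2 * d + 1)) := by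
  obtain ⟨j, hj⟩ : ∃ j, d = 2 * j := ⟨d / 2, by omega⟩
  have h := co_commutator_two_mul_second (by omega) (map_mem hf) (map_mem hg) (d := d) (j := j) (by omega)
    (f := red f) (g := red g)
  rw [show 2 * (j + d + 1) = 3 * d + 2 by omega, natCast_of_odd (by omega), natCast_of_even (by omega),
    ← hj] at h
  refine even_add_of_eq ?_
  rw [co_red_commutator, co_red_commutator, h,
    co_commutator_two_mul_add_one (by omega) (map_mem hf) (map_mem hg)]
  linear_combination (-(co (red g) d * co (red f) (d + 1))) * two_zmod

/-- At depth `2 * d + 2` the coefficient is twice an alternating form in depths `d` and `d + 2`; at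
`3 * d + 2` the same form reappears modulo 2. -/
theorem four_dvd_of_zero (hd : d % 4 = 0) (hd1 : 1 ≤ d) (hf : f ∈ V ℤ d) (hg : g ∈ V ℤ d) :
    (4 : ℤ) ∣ co ⁅f, g⁆ (2 * d + 2) + 2 * co ⁅f, g⁆ (3 * d + 2) := by
  obtain ⟨j, hj⟩ : ∃ j, d = 2 * j := ⟨d / 2, by omega⟩
  have h := co_commutator_two_mul_second (by omega) (map_mem hf) (map_mem hg) (d := d) (j := j) (by omega)
    (f := red f) (g := red g)
  rw [show 2 * (j + d + 1) = 3 * d + 2 by omega, natCast_of_even (by omega), natCast_of_odd (by omega),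
    ← hj] at h
  refine four_dvd_of_eq (y := co f (d + 2) * co g d - co g (d + 2) * co f d) ?_ ?_
  · have h1 := co_mul_of_lt_depth (r := 2) hf hg hd1 (by omega)
    have h2 := co_mul_of_lt_depth (r := 2) hg hf hd1 (by omega)
    rw [← two_mul, Finset.sum_range_succ, Finset.sum_range_succ, Finset.sum_range_one] at h1 h2
    simp only [add_zero, Nat.sub_zero, Nat.sub_self, Nat.reduceSub] at h1 h2
    rw [co_commutator_of_lt hd1 hf hg (by omega) (by omega), h1, h2]
    push_cast
    ring
  · rw [co_red_commutator, h]
    push_cast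
    simp only [co_red]
    ring

theorem even_co_first_of_three (hd : d % 4 = 3) (hf : f ∈ V ℤ d) (hg : g ∈ V ℤ d) :
    Even (co ⁅f, g⁆ (3 * d + 1)) := by
  obtain ⟨j, hj⟩ : ∃ j, d + 1 = 2 * j := ⟨(d + 1) / 2, by omega⟩
  have h := co_commutator_two_mul_first (by omega) (map_mem hf) (map_mem hg) (d := d) (j := j) (by omega)
    (f := red f) (g := red g)
  rw [show 2 * (j + d) = 3 * d + 1 by omega, natCast_of_even (by omega), zero_mul] at h
  rw [← intCast_eq_zero_iff_even, co_red_commutator, h]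

theorem four_dvd_of_three (hd : d % 4 = 3) (hf : f ∈ V ℤ d) (hg : g ∈ V ℤ d) :
    (4 : ℤ) ∣ co ⁅f, g⁆ (2 * d + 4) + 2 * co ⁅f, g⁆ (3 * d + 5) +
      2 * (if d = 3 then 1 else 0) * co ⁅f, g⁆ (2 * d + 1) := by
  have h := co_commutator_two_mul_third hd (map_mem hf) (map_mem hg) (f := red f) (g := red g)
  have hc : ((co ⁅f, g⁆ (3 * d + 5) : ℤ) : ZMod 2) =
      ((co f (d + 3) * co g (d + 1) - co g (d + 3) * co f (d + 1) : ℤ) : ZMod 2) := by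
    rw [co_red_commutator, h]
    push_cast
    rw [co_red, co_red, co_red, co_red]
    linear_combination (((co g (d + 3) : ℤ) : ZMod 2) * ((co f (d + 1) : ℤ) : ZMod 2)) * two_zmod
  -- For `d = 3` the depth `2 * d + 4` equals `3 * d + 1`, so second-order terms enter. Modulo 4
  -- they leave `10 * (f₄ g₃² - g₄ f₃²)`, and since `a² ≡ a` modulo 2 this is cancelled by twice the
  -- coefficient of depth 7.
  by_cases h3 : d = 3
  · subst h3
    simp only [Nat.reduceMul, Nat.reduceAdd, if_true, mul_one] at hc ⊢
    have h7 : ((co ⁅f, g⁆ 7 : ℤ) : ZMod 2) = ((co f 3 * co g 4 + co g 3 * co f 4 : ℤ) : ZMod 2) := by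
      rw [co_red_commutator, co_commutator_two_mul_add_one (d := 3) (by omega) (map_mem hf) (map_mem hg)]
      push_cast
      rw [co_red, co_red, co_red, co_red]
    have key : ∀ {f g : Jennings ℤ}, f ∈ V ℤ 3 → g ∈ V ℤ 3 → co (f * g) 10 = co f 10 + co g 10 +
        4 * co f 3 * co g 7 + 5 * co f 4 * co g 6 + 6 * co f 5 * co g 5 + 7 * co f 6 * co g 4 +
        8 * co f 7 * co g 3 + 12 * co f 3 * co g 3 * co g 4 + 10 * co f 4 * co g 3 ^ 2 := by
      intro f g hf hg
      have h1 := co_mul (r := 4) hf hg (by omega) (by omega) (by omega)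
      have t6 := coeff_tl_sq (r := 0) (by omega) hg
      have t7 := coeff_tl_sq (r := 1) (by omega) hg
      have t5 := coeff_tl_sq_of_lt hg (show 5 < 2 * 3 by omega)
      have t4 := coeff_tl_sq_of_lt hg (show 4 < 2 * 3 by omega)
      have t3 := coeff_tl_sq_of_lt hg (show 3 < 2 * 3 by omega)
      simp only [Finset.sum_range_succ, Finset.sum_range_zero, Nat.reduceAdd, Nat.reduceMul,
        Nat.reduceSub, zero_add] at h1 t6 t7
      rw [h1, t7, t6, t5, t4, t3]
      have c4 : Nat.choose 4 2 = 6 := rfl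
      have c5 : Nat.choose 5 2 = 10 := rfl
      rw [c4, c5]
      push_cast
      ring
    have hcm := co_mul_of_lt_depth (r := 0) (commutator_mem_succ (by omega) hf hg) (mul_mem hg hf)
      (by omega) (by omega)
    have e : ⁅f, g⁆ * (g * f) = f * g := by
      rw [commutatorElement_def, mul_assoc (f * g), ← mul_inv_rev, inv_mul_cancel_right]
    simp only [Finset.sum_range_one, Nat.reduceAdd, Nat.reduceMul, Nat.sub_self] at hcm
    rw [e, key hf hg, key hg hf] at hcm
    push_cast at hcm
    obtain ⟨u, hu⟩ := even_add_of_eq hc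
    obtain ⟨v, hv⟩ := even_add_of_eq h7
    obtain ⟨p, hp⟩ := (Int.even_mul_pred_self (co f 3)).two_dvd
    obtain ⟨q, hq⟩ := (Int.even_mul_pred_self (co g 3)).two_dvd
    refine ⟨-(co f 3 * co g 7) + co g 3 * co f 7 +
      3 * (co f 3 * co g 3 * co g 4 - co g 3 * co f 3 * co f 4) + 2 * co f 4 * co g 3 -
      3 * co g 4 * co f 3 + 5 * co f 4 * q - 5 * co g 4 * p - 2 * co ⁅f, g⁆ 7 * co (g * f) 3 + u + v, ?_⟩
    linear_combination (-1) * hcm + 2 * hu + 2 * hv + 10 * co f 4 * hq - 10 * co g 4 * hp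
  · rw [if_neg h3, mul_zero, zero_mul, add_zero]
    refine four_dvd_of_eq (y := 2 * (co f (d + 4) * co g d - co g (d + 4) * co f d) +
      (co f (d + 3) * co g (d + 1) - co g (d + 3) * co f (d + 1))) ?_ ?_
    · have h1 := co_mul_of_lt_depth (r := 4) hf hg (by omega) (by omega)
      have h2 := co_mul_of_lt_depth (r := 4) hg hf (by omega) (by omega)
      rw [← two_mul] at h1 h2
      simp only [Finset.sum_range_succ, Finset.sum_range_zero, zero_add, add_zero, Nat.sub_zero,
        Nat.sub_self, Nat.reduceSub] at h1 h2
      rw [co_commutator_of_lt (by omega) hf hg (by omega) (by omega), h1, h2]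
      push_cast
      ring
    · rw [hc]
      push_cast
      linear_combination (-(((co f (d + 4) : ℤ) : ZMod 2) * ((co g d : ℤ) : ZMod 2) -
        ((co g (d + 4) : ℤ) : ZMod 2) * ((co f d : ℤ) : ZMod 2))) * two_zmod

/-! ### The four residue classes of `d` modulo 4. -/

theorem nonempty_equiv_of_one (hd : d % 4 = 1) :
    Nonempty (Additive (Abelianization (level ℤ (d + 1))) ≃+
      (Fin (d + 1) → ℤ) × (Fin ((d + 3) / 2) → ZMod 2)) := by
  -- All even depths from `2 * d + 2` to `3 * d + 3`. The correction is needed at `3 * d + 1`, and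
  -- for `d = 1` also at depth 6.
  refine nonempty_equiv_zmod_two (by omega) (fun i => 2 * d + 2 + 2 * i)
    (fun i => if 2 * d + 2 + 2 * (i : ℕ) = 3 * d + 1 ∨ d = 1 then 1 else 0) ?_ ?_ ?_ ?_
  · intro i j h
    ext
    dsimp only at h
    omega
  · intro i
    have := i.2
    refine ⟨?_, ?_, ?_⟩
    · rw [Nat.even_iff]; omega
    all_goals omega
  · intro f hf g hg i
    have hi := i.2
    rcases lt_trichotomy (2 * d + 2 + 2 * (i : ℕ)) (3 * d + 1) with h | h | h
    · rw [if_neg (by omega), zero_mul, add_zero]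
      exact even_co_commutator_of_lt (by omega) hf hg (by omega) (by rw [Nat.even_iff]; omega) (by omega)
    · rw [if_pos (Or.inl h), one_mul, h]
      exact even_co_first_of_one hd hf hg
    · have h' : 2 * d + 2 + 2 * (i : ℕ) = 3 * d + 3 := by omega
      rw [h']
      by_cases h1 : d = 1
      · subst h1
        rw [if_pos (Or.inr rfl), one_mul]
        exact even_co_six hf hg
      · rw [if_neg (by omega), zero_mul, add_zero]
        exact even_co_second_of_one hd h1 hf hg
  · intro N hN he hne a
    rw [Nat.even_iff] at he
    by_cases h : N ≤ 3 * d + 3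
    · exact absurd (by dsimp only; omega) (hne ⟨(N - 2 * d - 2) / 2, by omega⟩)
    · exact leads_of_even_of_le (by omega) (by omega) he (by omega) (by omega) a

theorem nonempty_equiv_of_two (hd : d % 4 = 2) :
    Nonempty (Additive (Abelianization (level ℤ (d + 1))) ≃+
      (Fin (d + 1) → ℤ) × (Fin ((d + 2) / 2) → ZMod 2)) := by
  -- The even depths from `2 * d + 2` to `3 * d + 2`; only the last needs the correction.
  refine nonempty_equiv_zmod_two (by omega) (fun i => 2 * d + 2 + 2 * i)
    (fun i => if 2 * d + 2 + 2 * (i : ℕ) = 3 * d + 2 then 1 else 0) ?_ ?_ ?_ ?_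
  · intro i j h
    ext
    dsimp only at h
    omega
  · intro i
    have := i.2
    refine ⟨?_, ?_, ?_⟩
    · rw [Nat.even_iff]; omega
    all_goals omega
  · intro f hf g hg i
    have hi := i.2
    rcases lt_trichotomy (2 * d + 2 + 2 * (i : ℕ)) (3 * d) with h | h | h
    · rw [if_neg (by omega), zero_mul, add_zero]
      exact even_co_commutator_of_lt (by omega) hf hg (by omega) (by rw [Nat.even_iff]; omega) (by omega)
    · rw [if_neg (by omega), zero_mul, add_zero, h]
      exact even_co_first_of_even (by omega) (by omega) hf hg
    · have h' : 2 * d + 2 + 2 * (i : ℕ) = 3 * d + 2 := by omega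
      rw [if_pos h', one_mul, h']
      exact even_co_second_of_two hd hf hg
  · intro N hN he hne a
    rw [Nat.even_iff] at he
    by_cases h : N ≤ 3 * d + 2
    · exact absurd (by dsimp only; omega) (hne ⟨(N - 2 * d - 2) / 2, by omega⟩)
    · exact leads_of_even_of_le (by omega) (by omega) he (by omega) (by omega) a

theorem nonempty_equiv_of_zero (hd0 : 1 ≤ d) (hd : d % 4 = 0) :
    Nonempty (Additive (Abelianization (level ℤ (d + 1))) ≃+
      (Fin (d + 1) → ℤ) × ZMod 4 × (Fin ((d - 2) / 2) → ZMod 2)) := by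
  -- The depths `2 * d + 2` and `3 * d + 2` share the `ZMod 4`; the even depths strictly between
  -- them give the factors `ZMod 2`.
  refine nonempty_equiv_zmod_four (by omega) (fun i => 2 * d + 4 + 2 * i) (n₁ := 2 * d + 2)
    (n₂ := 3 * d + 2) 0 ?_ ?_ ?_ (by omega) (by omega) (by omega) ?_ ?_ ?_ ?_ ?_ ?_
  · intro i j h
    ext
    dsimp only at h
    omega
  · intro i
    have := i.2
    refine ⟨?_, ?_, ?_⟩
    · rw [Nat.even_iff]; omega
    all_goals omega
  · intro i; omega
  · rw [Nat.even_iff]; omega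
  · rw [Nat.even_iff]; omega
  · intro i; have := i.2; omega
  · intro f hf g hg i
    have hi := i.2
    rcases (by omega : 2 * d + 4 + 2 * (i : ℕ) < 3 * d ∨ 2 * d + 4 + 2 * (i : ℕ) = 3 * d) with h | h
    · exact even_co_commutator_of_lt (by omega) hf hg (by omega) (by rw [Nat.even_iff]; omega) (by omega)
    · rw [h]
      exact even_co_first_of_even (by omega) (by omega) hf hg
  · intro f hf g hg
    rw [mul_zero, zero_mul, add_zero]
    exact four_dvd_of_zero hd hd0 hf hg
  · intro N hN he hne h1 h2 a
    rw [Nat.even_iff] at he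
    by_cases h : N ≤ 3 * d
    · exact absurd (by dsimp only; omega) (hne ⟨(N - 2 * d - 4) / 2, by omega⟩)
    · exact leads_of_even_of_le (by omega) (by omega) he (by omega) (by omega) a

theorem nonempty_equiv_of_three (hd : d % 4 = 3) :
    Nonempty (Additive (Abelianization (level ℤ (d + 1))) ≃+
      (Fin (d + 1) → ℤ) × ZMod 4 × (Fin ((d - 1) / 2) → ZMod 2)) := by
  -- The even depths from `2 * d + 2` to `3 * d + 1`, where index 0 jumps over `n₁ = 2 * d + 4`.
  -- Depth `3 * d + 3` is absent, since `d + 3` is `2` modulo 4 and an odd leading coefficient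
  -- exists there.
  refine nonempty_equiv_zmod_four (by omega)
    (fun i => if (i : ℕ) = 0 then 2 * d + 2 else 2 * d + 4 + 2 * i) (n₁ := 2 * d + 4)
    (n₂ := 3 * d + 5) (if d = 3 then 1 else 0) ?_ ?_ ?_ (by omega) (by omega) (by omega) ?_ ?_ ?_ ?_ ?_ ?_
  · intro i j h
    ext
    dsimp only at h
    split_ifs at h <;> omega
  · intro i
    have := i.2
    rw [Nat.even_iff]
    split_ifs <;> omega
  · intro i
    split_ifs <;> omega
  · rw [Nat.even_iff]; omega
  · rw [Nat.even_iff]; omega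
  · intro i
    have := i.2
    split_ifs <;> omega
  · intro f hf g hg i
    have hi := i.2
    by_cases h : (if (i : ℕ) = 0 then 2 * d + 2 else 2 * d + 4 + 2 * i) = 3 * d + 1
    · rw [h]
      exact even_co_first_of_three hd hf hg
    · refine even_co_commutator_of_lt (by omega) hf hg ?_ ?_ ?_
      · split_ifs <;> omega
      · rw [Nat.even_iff]; split_ifs <;> omega
      · split_ifs at h ⊢ <;> omega
  · intro f hf g hg
    exact four_dvd_of_three hd hf hg
  · intro N hN he hne h1 h2 a
    rw [Nat.even_iff] at he
    by_cases h0 : N = 2 * d + 2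
    · exact absurd (by simp [h0]) (hne ⟨0, by omega⟩)
    by_cases h : N ≤ 3 * d + 1
    · refine absurd ?_ (hne ⟨(N - 2 * d - 4) / 2, by omega⟩)
      dsimp only
      rw [if_neg (by omega)]
      omega
    · exact leads_of_even_of_le (by omega) (by omega) he (by omega) (by omega) a

end Jennings

theorem theorem1p1 (k : ℕ) (hk : 2 ≤ k) :
    (k ≡ 3 [MOD 4] → Nonempty (Additive (Abelianization (Jennings.level ℤ k)) ≃+
      (Fin k → ℤ) × (Fin ((k + 1) / 2) → ZMod 2))) ∧
    (k ≡ 2 [MOD 4] → Nonempty (Additive (Abelianization (Jennings.level ℤ k)) ≃+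
      (Fin k → ℤ) × (Fin ((k + 2) / 2) → ZMod 2))) ∧
    (k ≡ 1 [MOD 4] → Nonempty (Additive (Abelianization (Jennings.level ℤ k)) ≃+
      (Fin k → ℤ) × ZMod 4 × (Fin ((k - 3) / 2) → ZMod 2))) ∧
    (k ≡ 0 [MOD 4] → Nonempty (Additive (Abelianization (Jennings.level ℤ k)) ≃+
      (Fin k → ℤ) × ZMod 4 × (Fin ((k - 2) / 2) → ZMod 2))) := by
  obtain ⟨d, rfl⟩ : ∃ d, k = d + 1 := ⟨k - 1, by omega⟩
  simp only [Nat.ModEq]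
  refine ⟨fun h => ?_, fun h => ?_, fun h => ?_, fun h => ?_⟩
  · exact Jennings.nonempty_equiv_of_two (by omega)
  · exact Jennings.nonempty_equiv_of_one (by omega)
  · exact Jennings.nonempty_equiv_of_zero (by omega) (by omega)
  · exact Jennings.nonempty_equiv_of_three (by omega)
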